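/- An augmented functor on groups is a pair $(\phi,\epsilon)$ of a functor $\phi:\mathrm{Groups}\to\mathrm{Groups}$ and a natural transformation $\epsilon_H:\phi(H)\to H$; it is idempotent if $\epsilon_{\phi(H)}$ and $\phi(\epsilon_H)$, both $\phi(\phi(H))\to\phi(H)$, are isomorphisms for every group $H$. For a group $G$ let $\mathrm{Idem}(G)$ be the collection of isomorphism classes of the groups $\phi(G)$ with $(\phi,\epsilon)$ idempotent. A cellular cover of $G$ is a homomorphism $c:A\to G$ for which $f\mapsto c\circ f$ is a bijection $\mathrm{Hom}(A,A)\to\mathrm{Hom}(A,G)$; two cellular covers $c:A\to G$ and $d:B\to G$ are equivalent if $d\circ h=c$ for some isomorphism $h:A\to B$, and $\mathrm{Cov}(G)$ is the collection of equivalence classes. Let $H_2(G)=H_2(G;\mathbb Z)$ be the Schur multiplier of $G$, and let $\mathrm{Inv\,Sub}(H_2(G))$ be the set of subgroups $L\subset H_2(G)$ such that $H_2(\sigma)(L)=L$ for every $\sigma\in\mathrm{Aut}(G)$. **Theorem.** Let $G$ be a finite simple group (possibly cyclic of prime order). Then there are bijections $$\alpha:\mathrm{Cov}(G)\to\mathrm{Idem}(G),\qquad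 \beta:\mathrm{Cov}(G)\to\{0\}\sqcup\mathrm{Inv\,Sub}(H_2(G)),$$ so that both $\mathrm{Cov}(G)$ and $\mathrm{Idem}(G)$ are in bijection with $\{0\}\sqcup\mathrm{Inv\,Sub}(H_2(G))$, with the following properties. 1. $\alpha$ sends the class of $c:A\to G$ to the isomorphism class of $A$. 2. Every cellular cover $c:A\to G$ either has $A$ trivial, and then $\beta([c])=0$, or is surjective, and then $\beta([c])$ is the image of $H_2(c):H_2(A)\to H_2(G)$ (an invariant subgroup). 3. If $G$ is not abelian, then $G$ has a universal central extension. For every universal central extension $e:E\to G$ the differential of $e$ is an isomorphism $\mu:H_2(G)\to\mathrm{Ker}(e)$; here the differential is the homomorphism that sends the class of a $2$-cycle $\sum_i n_i(g_i,h_i)$ of the inhomogeneous chain complex to $\prod_i\bigl(s(g_i)s(h_i)s(g_ih_i)^{-1}\bigr)^{n_i}$, for any set-theoretic section $s$ of $e$. For every $L\in\mathrm{Inv\,Sub}(H_2(G))$, with $K=\mu(L)$, the induced map $E/K\to G$ is a cellular cover and $\beta$ sends its class to $L$. A nontrivial group is isomorphic to $\phi(G)$ for some idempotent functor $(\phi,\epsilon)$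 if and only if it is isomorphic to $E/\mu(L)$ for some $L\in\mathrm{Inv\,Sub}(H_2(G))$. 4. If $G$ is abelian, then $H_2(G)=0$, and a nontrivial group is isomorphic to $\phi(G)$ for some idempotent functor $(\phi,\epsilon)$ if and only if it is isomorphic to $G$. -/

import Mathlib

universe u

open CategoryTheory

noncomputable section

namespace IdemGroups

/-! ### Idempotent functors and their values -/

/-- An augmented functor `(φ, ε)` on groups: an endofunctor `φ` of the category of groups together
with a natural transformation `ε : φ ⟶ id`. -/
structure AugmentedFunctor where
  /-- the endofunctor `φ` -/
  functor : GrpCat.{u} ⥤ GrpCat.{u}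
  /-- the augmentation `ε` -/
  aug : functor ⟶ 𝟭 GrpCat.{u}

/-- `(φ, ε)` is idempotent if both `ε_{φ(H)}` and `φ(ε_H)`, from `φ(φ(H))` to `φ(H)`, are
isomorphisms for every group `H`. -/
def AugmentedFunctor.IsIdempotent (φ : AugmentedFunctor.{u}) : Prop :=
  ∀ H : GrpCat.{u},
    IsIso (φ.aug.app (φ.functor.obj H)) ∧ IsIso (φ.functor.map (φ.aug.app H))

/-- Isomorphism classes of groups. -/
def IsoClass : Type (u + 1) := Quotient (isIsomorphicSetoid GrpCat.{u})

/-- The isomorphism class of a group. -/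
def isoClass (A : Type u) [Group A] : IsoClass.{u} :=
  Quotient.mk (isIsomorphicSetoid GrpCat.{u}) (GrpCat.of A)

/-- `Idem(G)`: the isomorphism classes of the values `φ(G)` of idempotent functors. -/
def Idem (G : Type u) [Group G] : Set IsoClass.{u} :=
  {x | ∃ φ : AugmentedFunctor.{u}, φ.IsIdempotent ∧ x = isoClass (φ.functor.obj (GrpCat.of G))}

/-! ### Cellular covers -/

/-- `c : A → G` is a cellular cover if `Hom(A, c) : Hom(A, A) → Hom(A, G)` is a bijection. -/
def IsCellularCover {A G : Type u} [Group A] [Group G] (c : A →* G) : Prop :=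
  Function.Bijective (fun f : A →* A => c.comp f)

/-- The cellular covers of `G`. -/
structure CellularCover (G : Type u) [Group G] where
  /-- the source of the cover -/
  A : Type u
  [group : Group A]
  /-- the cover itself -/
  hom : A →* G
  isCellularCover : IsCellularCover hom

attribute [instance] CellularCover.group

/-- Two cellular covers `c : A → G`, `d : B → G` are equivalent if `d ∘ h = c` for some
isomorphism `h : A → B`. -/
instance CellularCover.setoid (G : Type u) [Group G] : Setoid (CellularCover G) where
  r c d := ∃ h : c.A ≃* d.A, d.hom.comp h.toMonoidHom = c.hom
  iseqv :=
    { refl := fun c => ⟨MulEquiv.refl c.A, by ext; rfl⟩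
      symm := by
        rintro c d ⟨h, hh⟩
        refine ⟨h.symm, ?_⟩
        rw [← hh]
        ext x
        simp
      trans := by
        rintro c d e ⟨h, hh⟩ ⟨k, hk⟩
        refine ⟨h.trans k, ?_⟩
        rw [← hh, ← hk]
        ext x
        simp }

/-- `Cov(G)`: the equivalence classes of cellular covers of `G`. -/
def Cov (G : Type u) [Group G] : Type (u + 1) := Quotient (CellularCover.setoid G)

/-- The equivalence class of a cellular cover. -/
def CellularCover.toCov {G : Type u} [Group G] (c : CellularCover G) : Cov G :=
  Quotient.mk (CellularCover.setoid G) c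

/-! ### The Schur multiplier

Mathlib's group homology needs the coefficient ring in the universe of the group, so the integers
are lifted to that universe. -/

/-- The integers as a trivial `G`-module. -/
abbrev trivialInt (G : Type u) [Group G] : Rep.{u} (ULift.{u} ℤ) G :=
  Rep.trivial (ULift.{u} ℤ) G (ULift.{u} ℤ)

/-- The Schur multiplier `H₂(G) = H₂(G; ℤ)`. -/
abbrev H2 (G : Type u) [Group G] : Type u :=
  groupHomology.H2 (trivialInt G)

/-- The homomorphism `H₂(f) : H₂(X) → H₂(G)` induced by a homomorphism `f : X → G`. -/
def H2Map {X G : Type u} [Group X] [Group G] (f : X →* G) : H2 X →+ H2 G :=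
  (groupHomology.map (A := trivialInt X) (B := trivialInt G) f
    (𝟙 (trivialInt X)) 2).hom.toAddMonoidHom

/-- A subgroup of `H₂(G)` is invariant if every automorphism of `G` maps it onto itself. -/
def IsInvariant {G : Type u} [Group G] (L : AddSubgroup (H2 G)) : Prop :=
  ∀ σ : G ≃* G, L.map (H2Map σ.toMonoidHom) = L

/-- `Inv Sub(H₂(G))`: the `Aut(G)`-invariant subgroups of the Schur multiplier. -/
def InvSub (G : Type u) [Group G] : Type u := {L : AddSubgroup (H2 G) // IsInvariant L}

/-! ### Central extensions -/

/-- The central extensions of `G`. -/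
structure CentralExtension (G : Type u) [Group G] where
  /-- the total group -/
  E : Type u
  [group : Group E]
  /-- the projection -/
  hom : E →* G
  surjective : Function.Surjective hom
  central : hom.ker ≤ Subgroup.center E

attribute [instance] CentralExtension.group

namespace CentralExtension

variable {G : Type u} [Group G]

/-- A central extension of `G` is universal if it has a unique morphism over `G` to every central
extension of `G`. -/
def IsUniversal (e : CentralExtension G) : Prop :=
  ∀ d : CentralExtension G, ∃! h : e.E →* d.E, d.hom.comp h = e.hom

instance kerCommGroup (e : CentralExtension G) : CommGroup e.hom.ker :=
  { (inferInstance : Group e.hom.ker) with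
    mul_comm := fun x y =>
      Subtype.ext (Subgroup.mem_center_iff.mp (e.central y.2) (x : e.E)) }

/-- The element `s(g) s(h) s(gh)⁻¹` of the kernel, for a set-theoretic section `s`. -/
def factorSet (e : CentralExtension G) (s : G → e.E) (hs : ∀ g, e.hom (s g) = g) (g h : G) :
    e.hom.ker :=
  ⟨s g * s h * (s (g * h))⁻¹, by simp [MonoidHom.mem_ker, hs]⟩

/-- `μ` is the differential `H₂(G) → Ker(e)` of the central extension `e`: for every set-theoretic
section `s`, the class of a 2-cycle `∑ nᵢ (gᵢ, hᵢ)` is sent to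
`∏ (s(gᵢ) s(hᵢ) s(gᵢ hᵢ)⁻¹) ^ nᵢ` (written additively). -/
def IsDifferential (e : CentralExtension G) (μ : H2 G →+ Additive e.hom.ker) : Prop :=
  ∀ (s : G → e.E) (hs : ∀ g, e.hom (s g) = g) (z : groupHomology.cycles₂ (trivialInt G)),
    μ (groupHomology.H2π (trivialInt G) z) =
      Finsupp.sum (z : G × G →₀ ULift.{u} ℤ)
        (fun p n => n.down • Additive.ofMul (e.factorSet s hs p.1 p.2))

instance normal_map (e : CentralExtension G) (K : Subgroup e.hom.ker) :
    (K.map e.hom.ker.subtype).Normal :=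
  ⟨by
    rintro _ ⟨k, hk, rfl⟩ g
    refine ⟨k, hk, ?_⟩
    have h := Subgroup.mem_center_iff.mp (e.central k.2) g
    simp [h]⟩

/-- For a subgroup `K` of the kernel of `e : E → G`, the central extension `E/K → G`. -/
def quot (e : CentralExtension G) (K : Subgroup e.hom.ker) : CentralExtension G where
  E := e.E ⧸ K.map e.hom.ker.subtype
  hom := QuotientGroup.lift (K.map e.hom.ker.subtype) e.hom (by
    rintro _ ⟨k, _, rfl⟩
    exact k.2)
  surjective := fun g => by
    obtain ⟨x, rfl⟩ := e.surjective g
    exact ⟨(x : e.E ⧸ K.map e.hom.ker.subtype), rfl⟩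
  central := by
    intro x hx
    induction x using QuotientGroup.induction_on with
    | H x =>
      have hx' : x ∈ e.hom.ker := hx
      rw [Subgroup.mem_center_iff]
      intro y
      induction y using QuotientGroup.induction_on with
      | H y =>
        rw [← QuotientGroup.mk_mul, ← QuotientGroup.mk_mul,
          Subgroup.mem_center_iff.mp (e.central hx') y]

end CentralExtension

end IdemGroups

end

open IdemGroups

/-! A cellular cover `c : A → G` is a central extension, because conjugation by an element of `Ker
c` and the identity of `A` agree after `c`. Moreover every homomorphism `A → Ker c` is trivial,
because multiplying the identity of `A` by it does not change the composite with `c`. If `G` is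
abelian, this makes a surjective cover an isomorphism. If not, it makes `A` perfect
(`IsCellularCover.isPerfect`): the transfer to the center shows that `A` has finite exponent, while
the abelianization of `A` is divisible.

A perfect central extension of `G` is determined by the image of its Schur multiplier in `H₂(G)`,
which is the kernel of the differential (`mem_range_H2Map`). It is a cellular cover as soon as this
image is invariant: a nontrivial homomorphism `A → G` is `c` followed by an automorphism `σ`, and it
lifts when `H₂(σ)` preserves the image. The universal extension is the commutator subgroup of `Hat
G`, the extension given by the tautological cocycle with values in 2-chains modulo 2-boundaries; its
kernel is exactly `H₂(G)`.

The augmentation of an idempotent functor is a cellular cover, and a cover is determined by the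
isomorphism type of its source. Conversely, for perfect `A` the `A`-cellularization `F/[R, F]` is an
idempotent functor, and its value at `G` is `A` when `A` covers `G`. In the abelian case the
identity functor suffices for a surjective cover. -/

noncomputable section

namespace IdemGroups

/-! ### Perfect groups and central quotients -/

section Perfect

variable {P Q E X : Type*} [Group P] [Group Q] [Group E] [Group X]

/-- If `Q` is generated by the image of `f` and its center, then `f` maps the commutator subgroup
onto that of `Q`. -/
lemma commutator_eq_map (f : P →* Q) (h : ∀ q, ∃ p, ∃ z ∈ Subgroup.center Q, q = f p * z) :
    commutator Q = (commutator P).map f := by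
  apply le_antisymm
  · rw [commutator_def, Subgroup.commutator_le]
    intro a _ b _
    obtain ⟨p, z, hz, rfl⟩ := h a
    obtain ⟨q, w, hw, rfl⟩ := h b
    rw [Subgroup.mem_center_iff] at hz hw
    have h1 : f p * z * (f q * w) = f p * f q * (z * w) := by
      simp only [mul_assoc]
      rw [← mul_assoc z, ← hz (f q), mul_assoc]
    have h2 : f q * w * (f p * z) = f q * f p * (z * w) := by
      rw [hw z]
      simp only [mul_assoc]
      rw [← mul_assoc w, ← hw (f p), mul_assoc]
    change f p * z * (f q * w) * (f p * z)⁻¹ * (f q * w)⁻¹ ∈ _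
    rw [mul_assoc, ← mul_inv_rev, h1, h2]
    refine ⟨p * q * p⁻¹ * q⁻¹,
      Subgroup.commutator_mem_commutator (Subgroup.mem_top _) (Subgroup.mem_top _), ?_⟩
    simp [mul_assoc]
  · rw [commutator_def, Subgroup.map_commutator]
    exact Subgroup.commutator_mono le_top le_top

lemma commutator_eq_map_of_ker (f : P →* Q) (g : Q →* X) (hg : g.ker ≤ Subgroup.center Q)
    (h : Function.Surjective (g.comp f)) : commutator Q = (commutator P).map f := by
  apply commutator_eq_map
  intro q
  obtain ⟨p, hp⟩ := h (g q)
  refine ⟨p, (f p)⁻¹ * q, hg ?_, by group⟩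
  rw [MonoidHom.mem_ker, map_mul, map_inv, ← hp]
  simp

lemma surjective_of_isPerfect [Group.IsPerfect Q] (f : P →* Q) (g : Q →* X)
    (hg : g.ker ≤ Subgroup.center Q) (h : Function.Surjective (g.comp f)) :
    Function.Surjective f := by
  intro q
  have : q ∈ commutator Q := by simp
  rw [commutator_eq_map_of_ker f g hg h] at this
  obtain ⟨p, _, rfl⟩ := this
  exact ⟨p, rfl⟩

/-- The quotient of two homomorphisms that agree over a central quotient. -/
def quotientHom (c : E →* X) (hc : c.ker ≤ Subgroup.center E) (f g : P →* E)
    (h : c.comp f = c.comp g) : P →* c.ker where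
  toFun x := ⟨f x * (g x)⁻¹, by
    have := DFunLike.congr_fun h x
    simp only [MonoidHom.comp_apply] at this
    simp [MonoidHom.mem_ker, this]⟩
  map_one' := by ext; simp
  map_mul' x y := by
    ext
    have hx : f y * (g y)⁻¹ ∈ Subgroup.center E := hc (by
      have := DFunLike.congr_fun h y
      simp only [MonoidHom.comp_apply] at this
      simp [MonoidHom.mem_ker, this])
    have := Subgroup.mem_center_iff.mp hx (g x)⁻¹
    simp only [map_mul, mul_inv_rev, Subgroup.coe_mul]
    rw [mul_assoc (f x) (g x)⁻¹, this]
    group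

/-- The pointwise quotient of `f` and `g` is a homomorphism to the abelian group `Ker c`, so it
kills commutators. -/
lemma eqOn_commutator (c : E →* X) (hc : c.ker ≤ Subgroup.center E) (f g : P →* E)
    (h : c.comp f = c.comp g) {x : P} (hx : x ∈ commutator P) : f x = g x := by
  have : commutator P ≤ (quotientHom c hc f g h).ker := by
    rw [commutator_def, Subgroup.commutator_le]
    intro a _ b _
    rw [MonoidHom.mem_ker, map_commutatorElement, commutatorElement_eq_one_iff_mul_comm]
    ext
    exact (Subgroup.mem_center_iff.mp (hc ((quotientHom c hc f g h) b).2) _)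
  have := this hx
  rw [MonoidHom.mem_ker] at this
  have := congrArg Subtype.val this
  exact mul_inv_eq_one.mp this

lemma eq_of_isPerfect [Group.IsPerfect P] (c : E →* X) (hc : c.ker ≤ Subgroup.center E)
    (f g : P →* E) (h : c.comp f = c.comp g) : f = g := by
  ext x
  exact eqOn_commutator c hc f g h (by simp)

lemma isPerfect_of_nonabelian [IsSimpleGroup X] (h : ∃ x y : X, x * y ≠ y * x) :
    Group.IsPerfect X := by
  rw [Group.isPerfect_def]
  rcases IsSimpleGroup.eq_bot_or_eq_top_of_normal (commutator X) inferInstance with h1 | h1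
  · obtain ⟨x, y, hxy⟩ := h
    have : x * y * x⁻¹ * y⁻¹ ∈ commutator X :=
      Subgroup.commutator_mem_commutator (Subgroup.mem_top _) (Subgroup.mem_top _)
    rw [h1, Subgroup.mem_bot, mul_inv_eq_one, mul_inv_eq_iff_eq_mul] at this
    exact absurd this hxy
  · exact h1

end Perfect

/-! ### Structure of cellular covers of simple groups -/

section Cellular

variable {A G : Type u} [Group A] [Group G] {c : A →* G}

lemma IsCellularCover.hom_ext (hc : IsCellularCover c) {f g : A →* A}
    (h : c.comp f = c.comp g) : f = g := hc.1 h

lemma IsCellularCover.exists_lift (hc : IsCellularCover c) (f : A →* G) :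
    ∃ h : A →* A, c.comp h = f := hc.2 f

lemma IsCellularCover.ker_le_center (hc : IsCellularCover c) : c.ker ≤ Subgroup.center A := by
  intro k hk
  rw [Subgroup.mem_center_iff]
  intro g
  have h : (MulAut.conj k).toMonoidHom = MonoidHom.id A := by
    apply hc.hom_ext
    ext x
    simp [MonoidHom.mem_ker.mp hk]
  have := DFunLike.congr_fun h g
  simp only [MulEquiv.toMonoidHom_eq_coe, MonoidHom.coe_coe, MulAut.conj_apply,
    MonoidHom.id_apply] at this
  exact (mul_inv_eq_iff_eq_mul.mp this).symm

/-- Lifting `c` followed by an inner automorphism shows that the image of `c` is normal. If the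
image is trivial, the identity and the trivial endomorphism of `A` agree after `c`. -/
lemma IsCellularCover.subsingleton_or_surjective [IsSimpleGroup G] (hc : IsCellularCover c) :
    Subsingleton A ∨ Function.Surjective c := by
  have hn : c.range.Normal := by
    constructor
    rintro _ ⟨a, rfl⟩ g
    obtain ⟨h, hh⟩ := hc.exists_lift ((MulAut.conj g).toMonoidHom.comp c)
    refine ⟨h a, ?_⟩
    exact DFunLike.congr_fun hh a
  rcases IsSimpleGroup.eq_bot_or_eq_top_of_normal _ hn with h | h
  · left
    have h1 : MonoidHom.id A = 1 := by
      apply hc.hom_ext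
      ext x
      have : c x ∈ c.range := ⟨x, rfl⟩
      rw [h, Subgroup.mem_bot] at this
      simpa using this
    exact ⟨fun a b => (DFunLike.congr_fun h1 a).trans (DFunLike.congr_fun h1 b).symm⟩
  · exact Or.inr (MonoidHom.range_eq_top.mp h)

lemma IsCellularCover.hom_ker_eq_one (hc : IsCellularCover c) (f : A →* c.ker) : f = 1 := by
  let g : A →* A :=
    { toFun := fun a => a * (f a : A)
      map_one' := by simp
      map_mul' := fun a b => by
        have := Subgroup.mem_center_iff.mp (hc.ker_le_center (f a).2) b
        simp only [map_mul, Subgroup.coe_mul]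
        rw [mul_assoc a (f a : A), ← mul_assoc (f a : A) b, ← this]
        simp only [mul_assoc] }
  have hg : g = MonoidHom.id A := by
    apply hc.hom_ext
    ext a
    simp [g, MonoidHom.mem_ker.mp (f a).2]
  ext a
  have := DFunLike.congr_fun hg a
  simpa [g] using this

/-- `A` is abelian, being central over a cyclic group. The power map with exponent `|G|` lands in
`Ker c`, so it is trivial. Hence each `k` in `Ker c` is the image of a generator under some `G → Ker
c`; composing this with `c` gives `k = 1`. -/
lemma IsCellularCover.bijective_of_comm [IsSimpleGroup G] [Finite G]
    (hG : ∀ x y : G, x * y = y * x) (hc : IsCellularCover c) (hs : Function.Surjective c) :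
    Function.Bijective c := by
  let _ : CommGroup G := { (inferInstance : Group G) with mul_comm := hG }
  obtain ⟨g, hg⟩ := (IsSimpleGroup.isCyclic (α := G)).exists_generator
  obtain ⟨a, rfl⟩ := hs g
  have := c.isMulCommutative_of_isCyclic_of_ker_le_center hc.ker_le_center
  have hcomm : ∀ x y : A, x * y = y * x := fun x y => mul_comm' x y
  let _ : CommGroup A := { (inferInstance : Group A) with mul_comm := hcomm }
  have hp : ∀ x : A, x ^ Nat.card G = 1 := by
    intro x
    have := hc.hom_ker_eq_one ((powMonoidHom (Nat.card G) : A →* A).codRestrict c.ker (by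
      intro x
      simp [MonoidHom.mem_ker]))
    have := congrArg Subtype.val (DFunLike.congr_fun this x)
    simpa using this
  refine ⟨?_, hs⟩
  rw [injective_iff_map_eq_one]
  intro k hk
  let f : G →* c.ker := monoidHomOfForallMemZpowers (g := c a) hg (g' := (⟨k, hk⟩ : c.ker)) (by
    rw [orderOf_eq_card_of_forall_mem_zpowers hg]
    apply orderOf_dvd_of_pow_eq_one
    ext
    simp [hp])
  have := hc.hom_ker_eq_one (f.comp c)
  have := congrArg Subtype.val (DFunLike.congr_fun this a)
  simpa [f, monoidHomOfForallMemZpowers_apply_gen] using this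

lemma exists_dual_ne_zero_of_field {k V : Type*} [Field k] [AddCommGroup V] [Module k V] {v : V}
    (hv : v ≠ 0) : ∃ f : V →ₗ[k] k, f v ≠ 0 :=
  Module.Projective.exists_dual_ne_zero k hv

/-- An element that is not divisible by `p` is detected by a homomorphism to `ZMod p`. -/
lemma exists_zmod_hom_ne_zero {B : Type*} [AddCommGroup B] (p : ℕ) [Fact p.Prime] (x : B)
    (hx : ∀ y : B, p • y ≠ x) : ∃ f : B →+ ZMod p, f x ≠ 0 := by
  let N : AddSubgroup B := (nsmulAddMonoidHom (α := B) p).range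
  -- `B/pB` is a vector space over `ZMod p` in which `x` survives, so a linear functional detects
  -- it.
  let _ : Module (ZMod p) (B ⧸ N) := QuotientAddGroup.zmodModule (fun b => ⟨b, rfl⟩)
  have hv : (QuotientAddGroup.mk x : B ⧸ N) ≠ 0 := by
    intro h
    rw [QuotientAddGroup.eq_zero_iff] at h
    obtain ⟨y, hy⟩ := h
    exact hx y hy
  by_contra! hf
  obtain ⟨f, hf'⟩ := exists_dual_ne_zero_of_field (k := ZMod p) hv
  exact hf' <| hf (f.toAddMonoidHom.comp (QuotientAddGroup.mk' N))

/-- An element of order dividing `p` gives an injective homomorphism from `ZMod p`, unless it is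
trivial. -/
lemma exists_zmod_hom_injective {B : Type*} [AddCommGroup B] (p : ℕ) [Fact p.Prime] (k : B)
    (hk : p • k = 0) (hk0 : k ≠ 0) : ∃ g : ZMod p →+ B, ∀ t, g t = 0 → t = 0 := by
  let g : ZMod p →+ B := ZMod.lift p ⟨zmultiplesHom B k, by simpa using hk⟩
  have h2 : g 1 = k := by
    have := ZMod.lift_coe p (⟨zmultiplesHom B k, by simpa using hk⟩ : { f : ℤ →+ B // f p = 0 }) 1
    simpa [g] using this
  refine ⟨g, fun t ht => ?_⟩
  by_contra ht0
  have h1 : t⁻¹.val • g t = 0 := by rw [ht, smul_zero]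
  rw [← map_nsmul, nsmul_eq_mul, ZMod.natCast_zmod_val, inv_mul_cancel₀ ht0, h2] at h1
  exact hk0 h1

/-- The covers of a non-abelian finite simple group are perfect. -/
lemma IsCellularCover.isPerfect [Group.IsPerfect G] [Finite G]
    (hZ : Subgroup.center G = ⊥) (hc : IsCellularCover c) (hs : Function.Surjective c) :
    Group.IsPerfect A := by
  have hker : Subgroup.center A ≤ c.ker := by
    intro z hz
    have : c z ∈ Subgroup.center G := by
      rw [Subgroup.mem_center_iff]
      intro g
      obtain ⟨a, rfl⟩ := hs g
      rw [← map_mul, ← map_mul, Subgroup.mem_center_iff.mp hz]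
    rw [hZ] at this
    exact this
  have hcen : Subgroup.center A = c.ker := le_antisymm hker hc.ker_le_center
  have : c.ker.FiniteIndex := inferInstance
  have : (Subgroup.center A).FiniteIndex := hcen ▸ this
  set n := (Subgroup.center A).index with hn
  have hn0 : n ≠ 0 := Subgroup.FiniteIndex.index_ne_zero
  -- The transfer to the center is `a ↦ a ^ n`; its values lie in `Ker c`, so it is trivial.
  have hexp : ∀ a : A, a ^ n = 1 := by
    intro a
    have := hc.hom_ker_eq_one ((Subgroup.inclusion hker).comp (MonoidHom.transferCenterPow A))
    have := congrArg Subtype.val (DFunLike.congr_fun this a)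
    simpa [MonoidHom.transferCenterPow_apply] using this
  have hcov : ∀ a : A, ∃ k ∈ c.ker, Abelianization.of a = Abelianization.of k := by
    intro a
    have h1 : c a ∈ (commutator A).map c := by
      rw [← commutator_eq_map c (fun q => by
        obtain ⟨p, rfl⟩ := hs q
        exact ⟨p, 1, Subgroup.one_mem _, by simp⟩)]
      simp
    obtain ⟨b, hb, hba⟩ := h1
    refine ⟨a * b⁻¹, by simp [MonoidHom.mem_ker, hba], ?_⟩
    have : Abelianization.of b = 1 := by
      rw [← MonoidHom.mem_ker, Abelianization.ker_of]; exact hb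
    simp [this]
  have hdiv : ∀ p : ℕ, p.Prime → ∀ x : Abelianization A, ∃ y, y ^ p = x := by
    intro p hp x
    have := Fact.mk hp
    -- If `Ker c` has `p`-torsion, a class not divisible by `p` would give a nontrivial composite `A
    -- → Z/p → Ker c`. If not, every class is represented by an element of `Ker c` of order prime to
    -- `p`, which is a `p`-th power.
    by_cases hk : ∃ k : c.ker, k ^ p = 1 ∧ k ≠ 1
    · obtain ⟨k, hkp, hk1⟩ := hk
      by_contra! hx
      let _ : CommGroup c.ker := { (inferInstance : Group c.ker) with
        mul_comm := fun x y => Subtype.ext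
          (Subgroup.mem_center_iff.mp (hc.ker_le_center y.2) (x : A)) }
      obtain ⟨f, hf⟩ := exists_zmod_hom_ne_zero p (Additive.ofMul x)
        (fun y hy => hx y.toMul (congrArg Additive.toMul hy))
      obtain ⟨g, hg⟩ := exists_zmod_hom_injective p (Additive.ofMul k)
        (congrArg Additive.ofMul hkp) (fun h => hk1 (Additive.ofMul.injective h))
      obtain ⟨a, rfl⟩ := QuotientGroup.mk_surjective x
      have h3 := DFunLike.congr_fun (hc.hom_ker_eq_one
        ((AddMonoidHom.toMultiplicative (g.comp f)).comp Abelianization.of)) a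
      exact hf (hg _ (congrArg Additive.ofMul h3))
    · push Not at hk
      obtain ⟨a, rfl⟩ := QuotientGroup.mk_surjective x
      obtain ⟨k, hkc, hk'⟩ := hcov a
      have hfin : IsOfFinOrder k := isOfFinOrder_iff_pow_eq_one.mpr ⟨n, by lia, hexp k⟩
      have hcop : p.Coprime (orderOf k) := by
        rw [hp.coprime_iff_not_dvd]
        intro hd
        have h1 := orderOf_pow_orderOf_div hfin.orderOf_pos.ne' hd
        have h2 := hk ((⟨k, hkc⟩ : c.ker) ^ (orderOf k / p)) (by
          ext
          have := pow_orderOf_eq_one (k ^ (orderOf k / p))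
          rw [h1] at this
          simpa using this)
        have h3 : k ^ (orderOf k / p) = 1 := by simpa using congrArg Subtype.val h2
        rw [h3, orderOf_one] at h1
        exact hp.one_lt.ne h1
      obtain ⟨m, hm⟩ := exists_pow_eq_self_of_coprime hcop
      refine ⟨Abelianization.of (k ^ m), ?_⟩
      rw [← map_pow, ← pow_mul, mul_comm, pow_mul, hm]
      exact hk'.symm
  have hdiv' : ∀ m : ℕ, m ≠ 0 → ∀ x : Abelianization A, ∃ y, y ^ m = x := by
    intro m
    induction m using Nat.recOnMul with
    | zero => simp
    | one => exact fun _ x => ⟨x, pow_one x⟩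
    | prime p hp => exact fun _ => hdiv p hp
    | mul a b ha hb =>
      intro h x
      obtain ⟨y, rfl⟩ := hb (right_ne_zero_of_mul h) x
      obtain ⟨z, rfl⟩ := ha (left_ne_zero_of_mul h) y
      exact ⟨z, pow_mul z a b⟩
  rw [Group.isPerfect_def, eq_top_iff]
  intro a _
  rw [← Abelianization.ker_of, MonoidHom.mem_ker]
  -- A divisible group killed by `n` is trivial.
  obtain ⟨y, hy⟩ := hdiv' n hn0 (Abelianization.of a)
  obtain ⟨b, rfl⟩ := QuotientGroup.mk_surjective y
  rw [← hy]
  exact (map_pow Abelianization.of b n).symm.trans (by rw [hexp, map_one])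

end Cellular

/-! ### The universal 2-cocycle and the Schur multiplier -/

section UniversalCocycle

lemma finsupp_addHom_ext {α : Type*} {B : Type*} [AddCommGroup B]
    {f g : (α →₀ ULift.{u} ℤ) →+ B}
    (h : ∀ a, f (Finsupp.single a 1) = g (Finsupp.single a 1)) : f = g := by
  ext a n
  have hn : Finsupp.single a n = n.down • Finsupp.single a (1 : ULift.{u} ℤ) := by
    rw [Finsupp.smul_single]
    congr 1
    ext
    simp
  simp only [AddMonoidHom.comp_apply, Finsupp.singleAddHom_apply]
  rw [hn, map_zsmul, map_zsmul, h]

namespace CocycleGroup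

variable {X : Type u} {B : Type*} [AddCommGroup B]

/-- The sum of the values of `f` over a 2-chain. -/
def sumHom (f : X → X → B) : (X × X →₀ ULift.{u} ℤ) →+ B :=
  Finsupp.liftAddHom fun p =>
    (((zmultiplesHom B) (f p.1 p.2)).comp (AddEquiv.ulift (α := ℤ)).toAddMonoidHom)

lemma sumHom_apply (f : X → X → B) (z : X × X →₀ ULift.{u} ℤ) :
    sumHom f z = z.sum fun p n => n.down • f p.1 p.2 := by
  simp [sumHom, Finsupp.liftAddHom_apply]
  rfl

lemma sumHom_single (f : X → X → B) (g h : X) :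
    sumHom f (Finsupp.single (g, h) (1 : ULift.{u} ℤ)) = f g h := by
  rw [sumHom_apply, Finsupp.sum_single_index] <;> simp

end CocycleGroup

variable (X : Type u) [Group X]

/-- The target of the universal 2-cocycle on `X`: the 2-chains modulo the 2-boundaries. -/
def CocycleGroup : Type u :=
  (X × X →₀ ULift.{u} ℤ) ⧸ (groupHomology.boundaries₂ (trivialInt X)).toAddSubgroup

instance : AddCommGroup (CocycleGroup X) :=
  inferInstanceAs (AddCommGroup
    ((X × X →₀ ULift.{u} ℤ) ⧸ (groupHomology.boundaries₂ (trivialInt X)).toAddSubgroup))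

namespace CocycleGroup

variable {X}

/-- The class of a 2-chain. -/
def mk : (X × X →₀ ULift.{u} ℤ) →+ CocycleGroup X :=
  QuotientAddGroup.mk' (groupHomology.boundaries₂ (trivialInt X)).toAddSubgroup

lemma mk_surjective : Function.Surjective (mk (X := X)) :=
  QuotientAddGroup.mk'_surjective _

lemma mk_eq_zero {z : X × X →₀ ULift.{u} ℤ} :
    mk z = 0 ↔ z ∈ groupHomology.boundaries₂ (trivialInt X) :=
  QuotientAddGroup.eq_zero_iff z

/-- The universal 2-cocycle. -/
def pair (g h : X) : CocycleGroup X := mk (Finsupp.single (g, h) 1)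

lemma pair_cocycle (g h j : X) : pair g h + pair (g * h) j = pair h j + pair g (h * j) := by
  have : mk (X := X) (groupHomology.d₃₂ (trivialInt X) (Finsupp.single (g, h, j) 1)) = 0 :=
    mk_eq_zero.mpr ⟨_, rfl⟩
  rw [groupHomology.d₃₂_single] at this
  have h2 : pair h j - pair (g * h) j + pair g (h * j) - pair g h = 0 := by
    rw [← this]
    simp [pair]
  rw [sub_eq_zero] at h2
  rw [← h2]
  abel

lemma pair_one_left (g : X) : pair 1 g = pair 1 1 := by
  have := pair_cocycle 1 1 g
  simpa using this.symm

lemma pair_one_right (g : X) : pair g 1 = pair 1 1 := by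
  have := pair_cocycle g 1 1
  simpa using this

variable {B : Type*} [AddCommGroup B]

lemma hom_ext {f g : CocycleGroup X →+ B} (h : ∀ x y, f (pair x y) = g (pair x y)) : f = g := by
  have : f.comp mk = g.comp mk := finsupp_addHom_ext fun p => h p.1 p.2
  ext x
  obtain ⟨z, rfl⟩ := mk_surjective x
  exact DFunLike.congr_fun this z

/-- The homomorphism defined by a 2-cocycle. -/
def lift (f : X → X → B) (hf : ∀ g h j, f g h + f (g * h) j = f h j + f g (h * j)) :
    CocycleGroup X →+ B :=
  QuotientAddGroup.lift _ (sumHom f) (by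
    rintro _ ⟨z, rfl⟩
    have : (sumHom f).comp (groupHomology.d₃₂ (trivialInt X)).hom.toAddMonoidHom = 0 := by
      refine finsupp_addHom_ext fun p => ?_
      obtain ⟨g, h, j⟩ := p
      change sumHom f (groupHomology.d₃₂ (trivialInt X) (Finsupp.single (g, h, j) 1)) = 0
      rw [groupHomology.d₃₂_single]
      have : sumHom f (Finsupp.single (h, j) (1 : ULift.{u} ℤ) - Finsupp.single (g * h, j) 1 +
          Finsupp.single (g, h * j) 1 - Finsupp.single (g, h) 1) = 0 := by
        simp only [map_sub, map_add, sumHom_single]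
        rw [sub_eq_zero, sub_add_eq_add_sub, sub_eq_iff_eq_add, hf]
      simpa using this
    exact DFunLike.congr_fun this z)

lemma lift_mk (f : X → X → B) (hf) (z : X × X →₀ ULift.{u} ℤ) :
    lift f hf (mk z) = z.sum fun p n => n.down • f p.1 p.2 :=
  sumHom_apply f z

@[simp]
lemma lift_pair (f : X → X → B) (hf) (g h : X) : lift f hf (pair g h) = f g h :=
  sumHom_single f g h

/-- The boundary map on 2-chains. -/
def chainBoundary : (X × X →₀ ULift.{u} ℤ) →+ (X →₀ ULift.{u} ℤ) :=
  (groupHomology.d₂₁ (trivialInt X)).hom.toAddMonoidHom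

/-- The homomorphism induced by the boundary map on 2-chains. -/
def boundary : CocycleGroup X →+ (X →₀ ULift.{u} ℤ) :=
  QuotientAddGroup.lift _ chainBoundary (by
    rintro _ ⟨z, rfl⟩
    exact groupHomology.d₃₂_apply_mem_cycles₂ z)

lemma boundary_mk (z : X × X →₀ ULift.{u} ℤ) :
    boundary (mk z) = groupHomology.d₂₁ (trivialInt X) z := rfl

lemma boundary_pair (g h : X) : boundary (pair g h) =
    Finsupp.single h 1 - Finsupp.single (g * h) 1 + Finsupp.single g 1 := by
  rw [pair, boundary_mk, groupHomology.d₂₁_single]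
  simp

lemma H2π_surjective : Function.Surjective (groupHomology.H2π (trivialInt X)) :=
  (ModuleCat.epi_iff_surjective _).mp inferInstance

/-- The inclusion of the Schur multiplier. -/
def ofH2 : H2 X →+ CocycleGroup X :=
  (groupHomology.H2π (trivialInt X)).hom.toAddMonoidHom.liftOfSurjective H2π_surjective
    ⟨(mk (X := X)).comp (groupHomology.cycles₂ (trivialInt X)).subtype.toAddMonoidHom, by
      intro z hz
      exact mk_eq_zero.mpr ((groupHomology.H2π_eq_zero_iff z).mp hz)⟩

lemma ofH2_H2π (z : groupHomology.cycles₂ (trivialInt X)) :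
    ofH2 (groupHomology.H2π (trivialInt X) z) = mk (z : X × X →₀ ULift.{u} ℤ) :=
  AddMonoidHom.liftOfRightInverse_comp_apply _ _ _ _ z

lemma ofH2_injective : Function.Injective (ofH2 (X := X)) := by
  rw [injective_iff_map_eq_zero]
  intro x hx
  obtain ⟨z, rfl⟩ := H2π_surjective x
  rw [ofH2_H2π, mk_eq_zero] at hx
  exact (groupHomology.H2π_eq_zero_iff z).mpr hx

lemma boundary_eq_zero_iff (m : CocycleGroup X) : boundary m = 0 ↔ ∃ x, ofH2 x = m := by
  constructor
  · intro h
    obtain ⟨z, rfl⟩ := mk_surjective m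
    exact ⟨groupHomology.H2π (trivialInt X) ⟨z, h⟩, ofH2_H2π _⟩
  · rintro ⟨x, rfl⟩
    obtain ⟨z, rfl⟩ := H2π_surjective x
    rw [ofH2_H2π, boundary_mk]
    exact z.2

variable {Y : Type u} [Group Y]

/-- The homomorphism induced by a group homomorphism. -/
def map (f : X →* Y) : CocycleGroup X →+ CocycleGroup Y :=
  lift (fun g h => pair (f g) (f h)) fun g h j => by simp [pair_cocycle]

@[simp]
lemma map_pair (f : X →* Y) (g h : X) : map f (pair g h) = pair (f g) (f h) := by simp [map]

lemma map_ofH2 (f : X →* Y) (x : H2 X) : map f (ofH2 x) = ofH2 (H2Map f x) := by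
  obtain ⟨z, rfl⟩ := H2π_surjective x
  have h1 : H2Map f (groupHomology.H2π (trivialInt X) z) =
      groupHomology.H2π (trivialInt Y) (groupHomology.mapCycles₂ (A := trivialInt X)
        (B := trivialInt Y) f (𝟙 (trivialInt X)) z) :=
    groupHomology.H2π_comp_map_apply (A := trivialInt X) (B := trivialInt Y) f
      (𝟙 (trivialInt X)) z
  rw [h1, ofH2_H2π, ofH2_H2π]
  have : (map f).comp mk = (mk (X := Y)).comp (groupHomology.chainsMap₂ (A := trivialInt X)
        (B := trivialInt Y) f (𝟙 (trivialInt X))).hom.toAddMonoidHom := by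
    refine finsupp_addHom_ext fun p => ?_
    change map f (pair p.1 p.2) = mk (groupHomology.chainsMap₂ (A := trivialInt X)
        (B := trivialInt Y) f (𝟙 (trivialInt X)) (Finsupp.single p 1))
    rw [map_pair, pair]
    congr 1
    change _ = Finsupp.mapRange.linearMap _ (Finsupp.mapDomain _ (Finsupp.single p _))
    rw [Finsupp.mapDomain_single, Finsupp.mapRange.linearMap_apply, Finsupp.mapRange_single]
    rfl
  exact DFunLike.congr_fun this z.1

end CocycleGroup

end UniversalCocycle

lemma H2Map_comp {X Y Z : Type u} [Group X] [Group Y] [Group Z] (f : X →* Y) (g : Y →* Z)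
    (x : H2 X) :
    H2Map (g.comp f) x = H2Map g (H2Map f x) := by
  apply CocycleGroup.ofH2_injective
  simp only [← CocycleGroup.map_ofH2]
  have : CocycleGroup.map (g.comp f) = (CocycleGroup.map g).comp (CocycleGroup.map f) :=
    CocycleGroup.hom_ext fun x y => by simp
  rw [this]
  rfl

lemma H2Map_id {X : Type u} [Group X] (x : H2 X) : H2Map (MonoidHom.id X) x = x := by
  apply CocycleGroup.ofH2_injective
  rw [← CocycleGroup.map_ofH2]
  have : CocycleGroup.map (MonoidHom.id X) = AddMonoidHom.id _ :=
    CocycleGroup.hom_ext fun x y => by simp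
  rw [this]
  rfl

/-! ### The universal cocycle extension -/

/-- The central extension of `X` defined by the universal 2-cocycle. -/
@[ext]
structure Hat (X : Type u) [Group X] : Type u where
  /-- the coordinate in the group of coefficients -/
  fst : CocycleGroup X
  /-- the coordinate in the group -/
  snd : X

namespace Hat
open CocycleGroup
variable {X Y : Type u} [Group X] [Group Y]

instance : Mul (Hat X) := ⟨fun a b => ⟨a.fst + b.fst + pair a.snd b.snd, a.snd * b.snd⟩⟩
-- The universal cocycle is not normalized, hence the correction by `pair 1 1` here and in `inc`.
instance : One (Hat X) := ⟨⟨-pair 1 1, 1⟩⟩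
instance : Inv (Hat X) := ⟨fun a => ⟨-a.fst - pair a.snd⁻¹ a.snd - pair 1 1, a.snd⁻¹⟩⟩

@[simp] lemma mul_fst (a b : Hat X) : (a * b).fst = a.fst + b.fst + pair a.snd b.snd := rfl
@[simp] lemma mul_snd (a b : Hat X) : (a * b).snd = a.snd * b.snd := rfl
@[simp] lemma one_fst : (1 : Hat X).fst = -pair 1 1 := rfl
@[simp] lemma one_snd : (1 : Hat X).snd = 1 := rfl
@[simp] lemma inv_fst (a : Hat X) : (a⁻¹).fst = -a.fst - pair a.snd⁻¹ a.snd - pair 1 1 := rfl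
@[simp] lemma inv_snd (a : Hat X) : (a⁻¹).snd = a.snd⁻¹ := rfl

instance : Group (Hat X) := Group.ofLeftAxioms
  (fun a b c => by
    ext
    · simp only [mul_fst, mul_snd]
      have := pair_cocycle a.snd b.snd c.snd
      calc _ = a.fst + b.fst + c.fst + (pair a.snd b.snd + pair (a.snd * b.snd) c.snd) := by abel
        _ = _ := by rw [this]; abel
    · simp [mul_assoc])
  (fun a => by
    ext
    · simp [pair_one_left a.snd]
    · simp)
  (fun a => by
    ext
    · simp only [mul_fst, inv_fst, inv_snd, one_fst]; abel
    · simp)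

/-- The projection. -/
def proj : Hat X →* X where
  toFun := snd
  map_one' := rfl
  map_mul' _ _ := rfl

@[simp] lemma proj_apply (a : Hat X) : proj a = a.snd := rfl

/-- The inclusion of the kernel of the projection. -/
def inc : Multiplicative (CocycleGroup X) →* Hat X where
  toFun m := ⟨m.toAdd - pair 1 1, 1⟩
  map_one' := by ext <;> simp
  map_mul' a b := by
    ext
    · simp only [toAdd_mul, mul_fst]; abel
    · simp

lemma inc_injective : Function.Injective (inc (X := X)) := by
  intro a b h
  have := congrArg fst h
  exact Multiplicative.toAdd.injective (sub_left_injective this)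

lemma mem_ker_proj {a : Hat X} : a ∈ (proj (X := X)).ker ↔ ∃ m, inc m = a := by
  rw [MonoidHom.mem_ker]
  constructor
  · intro h
    refine ⟨Multiplicative.ofAdd (a.fst + pair 1 1), ?_⟩
    ext
    · simp [inc]
    · exact h.symm
  · rintro ⟨m, rfl⟩
    rfl

lemma ker_proj_le_center : (proj (X := X)).ker ≤ Subgroup.center (Hat X) := by
  intro a ha
  rw [Subgroup.mem_center_iff]
  intro g
  have ha' : a.snd = 1 := ha
  ext
  · simp only [mul_fst, ha', pair_one_left g.snd, pair_one_right g.snd]; abel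
  · simp [ha']

lemma proj_surjective : Function.Surjective (proj (X := X)) := fun x => ⟨⟨0, x⟩, rfl⟩

/-- An element of the kernel lies in the commutator subgroup exactly if it comes from the Schur
multiplier. -/
lemma inc_mem_commutator_iff (m : CocycleGroup X) :
    inc (Multiplicative.ofAdd m) ∈ commutator (Hat X) ↔ ∃ x, ofH2 x = m := by
  rw [← boundary_eq_zero_iff]
  constructor
  · intro h
    -- A homomorphism to the abelian group of 1-chains that restricts to the boundary map on the
    -- kernel of the projection.
    let D : Hat X →* Multiplicative (X →₀ ULift.{u} ℤ) :=
      { toFun := fun a => Multiplicative.ofAdd (boundary a.fst + Finsupp.single a.snd 1)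
        map_one' := by simp [boundary_pair]
        map_mul' := fun a b => by
          rw [← ofAdd_add]
          congr 1
          simp only [mul_fst, mul_snd, map_add, boundary_pair]
          abel }
    have h1 := Abelianization.commutator_subset_ker D h
    have h2 : boundary (m - pair 1 1) + Finsupp.single (1 : X) 1 = 0 := h1
    rw [map_sub, boundary_pair] at h2
    simpa using h2
  · intro h
    rw [← Abelianization.ker_of, MonoidHom.mem_ker]
    let q : Hat X →* Abelianization (Hat X) := Abelianization.of
    -- Conversely, the class of `inc m` in the abelianization depends only on the boundary of `m`:
    -- it is `S` of that boundary.
    let S : (X →₀ ULift.{u} ℤ) →+ Additive (Abelianization (Hat X)) :=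
      Finsupp.liftAddHom fun g => ((zmultiplesHom _) (Additive.ofMul (q ⟨0, g⟩))).comp
        (AddEquiv.ulift (α := ℤ)).toAddMonoidHom
    have hS : ∀ g : X, S (Finsupp.single g 1) = Additive.ofMul (q ⟨0, g⟩) := by
      intro g
      simp only [S, Finsupp.liftAddHom_apply_single]
      exact one_zsmul _
    have key : S.comp boundary = (MonoidHom.toAdditiveRight (q.comp inc)) := by
      apply hom_ext
      intro g h
      have h1 : (⟨0, g⟩ : Hat X) * ⟨0, h⟩ = inc (Multiplicative.ofAdd (pair g h)) * ⟨0, g * h⟩ := by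
        ext
        · simp [inc, pair_one_left (g * h)]
        · simp [inc]
      have h2 := congrArg (fun t => Additive.ofMul (q t)) h1
      simp only [map_mul, ofMul_mul] at h2
      simp only [AddMonoidHom.comp_apply, boundary_pair, map_add, map_sub, hS]
      rw [sub_add_eq_add_sub, sub_eq_iff_eq_add, add_comm, h2]
      rfl
    have := DFunLike.congr_fun key m
    rw [AddMonoidHom.comp_apply, h, map_zero] at this
    exact Additive.ofMul.injective this.symm

/-- The homomorphism induced by a group homomorphism. -/
def map (f : X →* Y) : Hat X →* Hat Y where
  toFun a := ⟨CocycleGroup.map f a.fst, f a.snd⟩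
  map_one' := by ext <;> simp
  map_mul' a b := by ext <;> simp

@[simp] lemma map_fst (f : X →* Y) (a : Hat X) : (map f a).fst = CocycleGroup.map f a.fst := rfl
@[simp] lemma map_snd (f : X →* Y) (a : Hat X) : (map f a).snd = f a.snd := rfl

lemma map_inc (f : X →* Y) (m : CocycleGroup X) :
    map f (inc (Multiplicative.ofAdd m)) = inc (Multiplicative.ofAdd (CocycleGroup.map f m)) := by
  ext <;> simp [inc]

/-- The image of an element of the Schur multiplier in `Hat X`. -/
def ofH2 (x : H2 X) : Hat X := inc (Multiplicative.ofAdd (CocycleGroup.ofH2 x))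

lemma ofH2_injective : Function.Injective (ofH2 (X := X)) := fun _ _ h =>
  CocycleGroup.ofH2_injective (Multiplicative.ofAdd.injective (inc_injective h))

lemma proj_ofH2 (x : H2 X) : proj (ofH2 x) = 1 := rfl

lemma ofH2_mem_commutator (x : H2 X) : ofH2 x ∈ commutator (Hat X) :=
  (inc_mem_commutator_iff _).mpr ⟨x, rfl⟩

lemma exists_ofH2 {a : Hat X} (ha : a ∈ commutator (Hat X)) (h : proj a = 1) :
    ∃ x, ofH2 x = a := by
  obtain ⟨m, rfl⟩ := mem_ker_proj.mp h
  obtain ⟨x, hx⟩ := (inc_mem_commutator_iff m.toAdd).mp ha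
  refine ⟨x, ?_⟩
  rw [ofH2, hx]
  rfl

lemma map_ofH2 (f : X →* Y) (x : H2 X) : map f (ofH2 x) = ofH2 (H2Map f x) := by
  rw [ofH2, map_inc, CocycleGroup.map_ofH2]
  rfl

end Hat

/-! ### Homomorphisms from `Hat X` to central extensions -/

namespace CentralExtension
variable {X : Type u} [Group X] (e : CentralExtension X) (s : X → e.E) (hs : ∀ g, e.hom (s g) = g)

/-- The homomorphism on the universal coefficient group defined by a section. -/
def factorHom : CocycleGroup X →+ Additive e.hom.ker :=
  CocycleGroup.lift (fun g h => Additive.ofMul (e.factorSet s hs g h)) fun g h j => by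
    apply Additive.toMul.injective
    ext
    have := Subgroup.mem_center_iff.mp (e.central (e.factorSet s hs h j).2) (s g)
    simp only [factorSet] at this
    simp only [toMul_add, toMul_ofMul, Subgroup.coe_mul, factorSet]
    rw [mul_assoc g h j]
    calc _ = s g * (s h * s j * (s (h * j))⁻¹) * s (h * j) * (s (g * (h * j)))⁻¹ := by group
      _ = _ := by rw [this]; group

/-- The homomorphism over `X` defined by a section. -/
def hatHom : Hat X →* e.E where
  toFun a := (e.factorHom s hs a.fst).toMul * s a.snd
  map_one' := by simp [factorHom, factorSet]
  map_mul' a b := by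
    have := Subgroup.mem_center_iff.mp (e.central ((e.factorHom s hs b.fst).toMul).2) (s a.snd)
    simp only [Hat.mul_fst, Hat.mul_snd, map_add, toMul_add, Subgroup.coe_mul]
    rw [show e.factorHom s hs (CocycleGroup.pair a.snd b.snd) =
      Additive.ofMul (e.factorSet s hs a.snd b.snd) by simp [factorHom]]
    simp only [toMul_ofMul, factorSet]
    calc _ = ((e.factorHom s hs a.fst).toMul : e.E) *
          ((e.factorHom s hs b.fst).toMul * s a.snd) * s b.snd := by simp [mul_assoc]
      _ = _ := by rw [← this]; simp [mul_assoc]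

lemma hom_comp_hatHom : e.hom.comp (e.hatHom s hs) = Hat.proj := by
  ext a
  have : e.hom ((e.factorHom s hs a.fst).toMul : e.E) = 1 := (e.factorHom s hs a.fst).toMul.2
  simp [hatHom, this, hs]

lemma hatHom_inc (m : CocycleGroup X) :
    e.hatHom s hs (Hat.inc (Multiplicative.ofAdd m)) = (e.factorHom s hs m).toMul := by
  have : (e.factorHom s hs (CocycleGroup.pair 1 1)).toMul = e.factorSet s hs 1 1 := by
    simp [factorHom]
  have h2 : ((e.factorHom s hs (CocycleGroup.pair 1 1)).toMul : e.E) = s 1 := by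
    rw [this]; simp [factorSet]
  simp [hatHom, Hat.inc, h2]

end CentralExtension

/-! ### Cellularization with respect to a perfect group -/

section Cellularization

/-- `g` is an `A`-equivalence if composition with `g` is a bijection on homomorphisms from `A`. -/
def IsEquivalenceFor (A : Type u) [Group A] {P Q : Type u} [Group P] [Group Q] (g : P →* Q) :
    Prop :=
  Function.Bijective (fun f : A →* P => g.comp f)

/-- `X` is `A`-cellular if every `A`-equivalence is an `X`-equivalence. -/
def IsCellularGroup (A X : Type u) [Group A] [Group X] : Prop :=
  ∀ ⦃P Q : Type u⦄ [Group P] [Group Q] (g : P →* Q), IsEquivalenceFor A g → IsEquivalenceFor X g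

variable (A : Type u) [Group A]

/-- The free product of the copies of `A` indexed by the homomorphisms from `A` to `H`. -/
abbrev FreeCover (H : Type u) [Group H] : Type u := Monoid.CoprodI fun _ : A →* H => A

variable {A} {H : Type u} [Group H]

/-- The evaluation homomorphism. -/
def FreeCover.eval : FreeCover A H →* H := Monoid.CoprodI.lift fun f => f

variable (A H) in
/-- The group `F/[R, F]`, where `R` is the kernel of the evaluation `F → H` of the free cover. -/
abbrev Cell : Type u :=
  FreeCover A H ⧸ ⁅(FreeCover.eval (A := A) (H := H)).ker, (⊤ : Subgroup (FreeCover A H))⁆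

namespace Cell

lemma commutator_le_ker : ⁅(FreeCover.eval (A := A) (H := H)).ker, (⊤ : Subgroup (FreeCover A H))⁆ ≤
    (FreeCover.eval (A := A) (H := H)).ker := Subgroup.commutator_le_left _ _

/-- The augmentation. -/
def aug : Cell A H →* H := QuotientGroup.lift _ FreeCover.eval commutator_le_ker

/-- The inclusion of the copy of `A` belonging to `f`. -/
def incl (f : A →* H) : A →* Cell A H :=
  (QuotientGroup.mk' _).comp (Monoid.CoprodI.of (M := fun _ : A →* H => A) (i := f))

lemma aug_comp_incl (f : A →* H) : aug.comp (incl f) = f := by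
  ext a
  exact Monoid.CoprodI.lift_of (fi := fun f : A →* H => f) a

lemma hom_ext {P : Type*} [Group P] {g h : Cell A H →* P}
    (hgh : ∀ f, g.comp (incl f) = h.comp (incl f)) : g = h := by
  apply QuotientGroup.monoidHom_ext
  apply Monoid.CoprodI.ext_hom
  intro f
  exact hgh f

lemma ker_aug_le_center : (aug (A := A) (H := H)).ker ≤ Subgroup.center (Cell A H) := by
  intro x hx
  rw [Subgroup.mem_center_iff]
  intro y
  obtain ⟨r, rfl⟩ := QuotientGroup.mk_surjective x
  obtain ⟨t, rfl⟩ := QuotientGroup.mk_surjective y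
  have hr : r ∈ (FreeCover.eval (A := A) (H := H)).ker := hx
  have h := Subgroup.commutator_mem_commutator hr (Subgroup.mem_top t)
  have h2 : ((r * t * r⁻¹ * t⁻¹ : FreeCover A H) : Cell A H) = 1 :=
    (QuotientGroup.eq_one_iff _).mpr h
  rw [mul_assoc, ← mul_inv_rev, QuotientGroup.mk_mul, QuotientGroup.mk_inv, mul_inv_eq_one] at h2
  exact h2.symm

/-- Lifts exist through the copies of `A`; they are unique because `A` is perfect and the kernel of
`aug` is central. -/
lemma isEquivalenceFor_aug [Group.IsPerfect A] : IsEquivalenceFor A (aug (A := A) (H := H)) :=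
  ⟨fun f g h => eq_of_isPerfect aug ker_aug_le_center f g h, fun f => ⟨incl f, aug_comp_incl f⟩⟩

lemma isCellularGroup : IsCellularGroup A (Cell A H) := by
  intro P Q _ _ g hg
  refine ⟨fun h k hhk => hom_ext fun f => hg.1 ?_, fun k => ?_⟩
  · change g.comp (h.comp _) = g.comp (k.comp _)
    rw [← MonoidHom.comp_assoc, ← MonoidHom.comp_assoc]
    exact congrArg (fun t : Cell A H →* Q => t.comp (incl f)) hhk
  · choose l hl using fun f : A →* H => hg.2 (k.comp (incl f))
    simp only at hl
    let L : FreeCover A H →* P := Monoid.CoprodI.lift l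
    have hL : g.comp L = k.comp (QuotientGroup.mk' _) := by
      apply Monoid.CoprodI.ext_hom
      intro f
      ext a
      have h1 := DFunLike.congr_fun (hl f) a
      have h2 : L (Monoid.CoprodI.of (i := f) a) = l f a := Monoid.CoprodI.lift_of l a
      simp only [MonoidHom.comp_apply] at h1 ⊢
      rw [h2, h1]
      rfl
    have hN : ⁅(FreeCover.eval (A := A) (H := H)).ker, (⊤ : Subgroup (FreeCover A H))⁆ ≤ L.ker := by
      rw [Subgroup.commutator_le]
      intro r hr t _
      -- The class of `r` is central in `Cell A H`, so conjugation by `L r` is invisible after `g`.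
      -- As `g` is an `A`-equivalence, it is invisible on each copy of `A`.
      have hcomm : (MulAut.conj (L r)).toMonoidHom.comp L = L := by
        apply Monoid.CoprodI.ext_hom
        intro f
        apply hg.1
        ext a
        have hr' : (QuotientGroup.mk' _ r : Cell A H) ∈ (aug (A := A) (H := H)).ker := hr
        have h1 := Subgroup.mem_center_iff.mp (ker_aug_le_center hr')
          (QuotientGroup.mk' _ (Monoid.CoprodI.of (i := f) a))
        have h2 := congrArg k h1
        have h3 := fun x => DFunLike.congr_fun hL x
        simp only [MonoidHom.comp_apply] at h3
        rw [map_mul, map_mul, ← h3, ← h3] at h2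
        simp only [MonoidHom.comp_apply, MulEquiv.toMonoidHom_eq_coe, MonoidHom.coe_coe,
          MulAut.conj_apply, map_mul, map_inv]
        rw [← h2, mul_inv_cancel_right]
      have := DFunLike.congr_fun hcomm t
      simp only [MonoidHom.comp_apply, MulEquiv.toMonoidHom_eq_coe, MonoidHom.coe_coe,
        MulAut.conj_apply] at this
      change L (r * t * r⁻¹ * t⁻¹) = 1
      simp only [map_mul, map_inv]
      rw [this, mul_inv_cancel]
    refine ⟨QuotientGroup.lift _ L hN, ?_⟩
    apply QuotientGroup.monoidHom_ext
    exact hL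

variable [Group.IsPerfect A]

lemma existsUnique_lift {X H : Type u} [Group X] [Group H] (hX : IsCellularGroup A X)
    (f : X →* H) : ∃! h : X →* Cell A H, aug.comp h = f :=
  (hX aug isEquivalenceFor_aug).existsUnique f

variable (A) in
/-- The `A`-cellularization, as an augmented functor. -/
def augmentedFunctor : AugmentedFunctor.{u} where
  functor :=
    { obj := fun H => GrpCat.of (Cell A H)
      map := fun {H K} f => GrpCat.ofHom
        (existsUnique_lift (isCellularGroup (A := A)) (f.hom.comp aug)).choose
      map_id := fun H => by
        apply GrpCat.hom_ext
        exact (existsUnique_lift isCellularGroup _).unique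
          (existsUnique_lift isCellularGroup _).choose_spec.1 rfl
      map_comp := fun {H K L} f g => by
        apply GrpCat.hom_ext
        refine (existsUnique_lift isCellularGroup _).unique
          (existsUnique_lift isCellularGroup _).choose_spec.1 ?_
        simp only [GrpCat.hom_comp, GrpCat.hom_ofHom]
        rw [← MonoidHom.comp_assoc, (existsUnique_lift isCellularGroup (g.hom.comp aug)).choose_spec.1,
          MonoidHom.comp_assoc, (existsUnique_lift isCellularGroup (f.hom.comp aug)).choose_spec.1]
        rfl }
  aug :=
    { app := fun H => GrpCat.ofHom aug
      naturality := fun H K f => by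
        apply GrpCat.hom_ext
        exact (existsUnique_lift isCellularGroup (f.hom.comp aug)).choose_spec.1 }

/-- By uniqueness of lifts, a section of `ε` at `φ(H)` is a two-sided inverse, and `φ(ε_H) =
ε_{φ(H)}` since both lift the same map through `ε_H`. -/
lemma augmentedFunctor_isIdempotent : (augmentedFunctor A).IsIdempotent := by
  intro H
  have h1 : IsIso ((augmentedFunctor A).aug.app ((augmentedFunctor A).functor.obj H)) := by
    obtain ⟨s, hs, _⟩ := existsUnique_lift (isCellularGroup (A := A) (H := H))
      (MonoidHom.id (Cell A H))
    refine ⟨GrpCat.ofHom s, ?_, ?_⟩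
    · apply GrpCat.hom_ext
      refine (existsUnique_lift isCellularGroup aug).unique (y₁ := s.comp aug) ?_ rfl
      rw [← MonoidHom.comp_assoc, hs]
      rfl
    · exact GrpCat.hom_ext hs
  refine ⟨h1, ?_⟩
  have h2 : (augmentedFunctor A).functor.map ((augmentedFunctor A).aug.app H) =
      (augmentedFunctor A).aug.app ((augmentedFunctor A).functor.obj H) := by
    apply GrpCat.hom_ext
    refine (existsUnique_lift isCellularGroup _).unique
          (existsUnique_lift isCellularGroup _).choose_spec.1 rfl
  rw [h2]
  exact h1

end Cell

/-- `A` and `Cell A G` are both `A`-cellular and map to `G` by `A`-equivalences, so each map lifts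
uniquely through the other. -/
lemma mem_idem_of_isPerfect {A G : Type u} [Group A] [Group G] [Group.IsPerfect A] {c : A →* G}
    (hc : IsCellularCover c) : isoClass A ∈ Idem G := by
  refine ⟨Cell.augmentedFunctor A, Cell.augmentedFunctor_isIdempotent, ?_⟩
  have hA : IsCellularGroup A A := fun P Q _ _ g hg => hg
  have hcC := (Cell.isCellularGroup (A := A) (H := G)) c hc
  obtain ⟨f, hf, -⟩ := Cell.existsUnique_lift hA c
  obtain ⟨g, hg⟩ := hcC.2 Cell.aug
  simp only at hg
  have h1 : g.comp f = MonoidHom.id A := by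
    apply hc.1
    simp only
    rw [← MonoidHom.comp_assoc, hg, hf]
    rfl
  have h2 : f.comp g = MonoidHom.id _ := by
    refine (Cell.existsUnique_lift Cell.isCellularGroup Cell.aug).unique ?_ rfl
    rw [← MonoidHom.comp_assoc, hf, hg]
  exact Quotient.sound ⟨(MonoidHom.toMulEquiv f g h1 h2).toGrpIso⟩

end Cellularization

/-! ### Values of idempotent functors as sources of cellular covers -/

section Idempotent

/-- The augmentation of an idempotent functor is a cellular cover. -/
lemma AugmentedFunctor.IsIdempotent.isCellularCover {φ : AugmentedFunctor.{u}}
    (hφ : φ.IsIdempotent) (H : GrpCat.{u}) : IsCellularCover (φ.aug.app H).hom := by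
  have := (hφ H).1
  have := (hφ H).2
  constructor
  · intro f g h
    -- Cancelling `φ(ε_H)` gives `φ(f) = φ(g)`; naturality and cancelling `ε_{φ(H)}` then give `f =
    -- g`.
    have h1 : GrpCat.ofHom f ≫ φ.aug.app H = GrpCat.ofHom g ≫ φ.aug.app H := GrpCat.hom_ext h
    have h2 := congrArg φ.functor.map h1
    simp only [φ.functor.map_comp] at h2
    have h3 := (cancel_mono _).mp h2
    have h4 := φ.aug.naturality (GrpCat.ofHom f)
    have h5 := φ.aug.naturality (GrpCat.ofHom g)
    rw [h3, h5] at h4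
    have h6 := (cancel_epi (φ.aug.app (φ.functor.obj H))).mp h4
    exact (congrArg GrpCat.Hom.hom h6).symm
  · intro f
    let f' : φ.functor.obj H ⟶ H := GrpCat.ofHom f
    let h : φ.functor.obj H ⟶ φ.functor.obj H :=
      inv (φ.aug.app (φ.functor.obj H)) ≫ φ.functor.map f'
    refine ⟨h.hom, ?_⟩
    have h1 : h ≫ φ.aug.app H = f' := by
      simp only [h, Category.assoc]
      rw [φ.aug.naturality f', IsIso.inv_hom_id_assoc]
      rfl
    exact congrArg GrpCat.Hom.hom h1

lemma mem_idem_self (G : Type u) [Group G] : isoClass G ∈ Idem G :=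
  ⟨⟨𝟭 _, 𝟙 _⟩, fun H => ⟨inferInstanceAs (IsIso (𝟙 H)), inferInstanceAs (IsIso (𝟙 H))⟩, rfl⟩

lemma isoClass_eq_iff {A B : Type u} [Group A] [Group B] :
    isoClass A = isoClass B ↔ Nonempty (A ≃* B) := by
  constructor
  · intro h
    obtain ⟨i⟩ := Quotient.exact h
    exact ⟨i.groupIsoToMulEquiv⟩
  · rintro ⟨e⟩
    exact Quotient.sound ⟨e.toGrpIso⟩

/-- Cellular covers with isomorphic sources are equivalent. -/
lemma toCov_eq_of_mulEquiv {G : Type u} [Group G] (c d : CellularCover G) (e : c.A ≃* d.A) :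
    c.toCov = d.toCov := by
  obtain ⟨k, hk⟩ := c.isCellularCover.exists_lift (d.hom.comp e.toMonoidHom)
  obtain ⟨j, hj⟩ := d.isCellularCover.exists_lift (c.hom.comp e.symm.toMonoidHom)
  have hk' := fun x => DFunLike.congr_fun hk x
  have hj' := fun x => DFunLike.congr_fun hj x
  simp only [MonoidHom.comp_apply] at hk' hj'
  have h1 : k.comp (e.symm.toMonoidHom.comp (j.comp e.toMonoidHom)) = MonoidHom.id _ := by
    apply c.isCellularCover.hom_ext
    ext x
    simp [hk', hj']
  have h2 : j.comp (e.toMonoidHom.comp (k.comp e.symm.toMonoidHom)) = MonoidHom.id _ := by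
    apply d.isCellularCover.hom_ext
    ext x
    simp [hk', hj']
  -- The isomorphism is `j ∘ e`, with inverse `k ∘ e⁻¹`; it is written so that `h1` and `h2` apply.
  refine Quotient.sound ⟨MonoidHom.toMulEquiv (e.toMonoidHom.comp
    (e.symm.toMonoidHom.comp (j.comp e.toMonoidHom))) (k.comp e.symm.toMonoidHom) ?_ ?_, ?_⟩
  · ext x
    have := DFunLike.congr_fun h1 x
    simpa using this
  · ext x
    have := DFunLike.congr_fun h2 x
    simpa using this
  · ext x
    simp [hj']

/-- The isomorphism class of the source of a cellular cover. -/
def Cov.source {G : Type u} [Group G] : Cov G → IsoClass.{u} :=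
  Quotient.lift (fun c => isoClass c.A) fun _ _ ⟨h, _⟩ => isoClass_eq_iff.mpr ⟨h⟩

lemma Cov.source_injective {G : Type u} [Group G] : Function.Injective (Cov.source (G := G)) := by
  intro x y
  obtain ⟨c, rfl⟩ := Quotient.exists_rep x
  obtain ⟨d, rfl⟩ := Quotient.exists_rep y
  intro h
  obtain ⟨e⟩ := isoClass_eq_iff.mp h
  exact toCov_eq_of_mulEquiv c d e

lemma exists_cov_of_mem_idem {G : Type u} [Group G] {x : IsoClass.{u}} (hx : x ∈ Idem G) :
    ∃ c : Cov G, c.source = x := by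
  obtain ⟨φ, hφ, rfl⟩ := hx
  exact ⟨CellularCover.toCov ⟨_, _, hφ.isCellularCover (GrpCat.of G)⟩, rfl⟩

lemma center_eq_bot_of_nonabelian {G : Type*} [Group G] [IsSimpleGroup G]
    (h : ∃ x y : G, x * y ≠ y * x) : Subgroup.center G = ⊥ := by
  refine (IsSimpleGroup.eq_bot_or_eq_top_of_normal _ inferInstance).resolve_right fun h1 => ?_
  obtain ⟨x, y, hxy⟩ := h
  exact hxy (Subgroup.mem_center_iff.mp (h1 ▸ Subgroup.mem_top y) x)

lemma IsCellularCover.mem_idem {A G : Type u} [Group A] [Group G] [Finite G] [IsSimpleGroup G]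
    {c : A →* G} (hc : IsCellularCover c) : isoClass A ∈ Idem G := by
  rcases hc.subsingleton_or_surjective with h | h
  · exact mem_idem_of_isPerfect hc
  · by_cases hG : ∀ x y : G, x * y = y * x
    · have : isoClass A = isoClass G :=
        isoClass_eq_iff.mpr ⟨MulEquiv.ofBijective c (hc.bijective_of_comm hG h)⟩
      rw [this]
      exact mem_idem_self G
    · push Not at hG
      have := isPerfect_of_nonabelian hG
      have := hc.isPerfect (center_eq_bot_of_nonabelian hG) h
      exact mem_idem_of_isPerfect hc

/-- The equivalence classes of cellular covers correspond to the values of idempotent functors. -/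
def covEquivIdem (G : Type u) [Group G] [Finite G] [IsSimpleGroup G] : Cov G ≃ Idem G :=
  Equiv.ofBijective (fun c => ⟨c.source, by
      obtain ⟨c, rfl⟩ := Quotient.exists_rep c
      exact c.isCellularCover.mem_idem⟩)
    ⟨fun _ _ h => Cov.source_injective (congrArg Subtype.val h), fun x => by
      obtain ⟨c, hc⟩ := exists_cov_of_mem_idem x.2
      exact ⟨c, Subtype.ext hc⟩⟩

end Idempotent

/-! ### Perfect and universal central extensions -/

lemma Hat.proj_comp_subtype_surjective {G : Type u} [Group G] [Group.IsPerfect G] :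
    Function.Surjective ((Hat.proj (X := G)).comp (commutator (Hat G)).subtype) := by
  intro g
  have : g ∈ (commutator (Hat G)).map Hat.proj := by
    rw [← commutator_eq_map Hat.proj (fun q => by
      obtain ⟨p, rfl⟩ := Hat.proj_surjective q
      exact ⟨p, 1, Subgroup.one_mem _, by simp⟩)]
    simp
  obtain ⟨a, ha, rfl⟩ := this
  exact ⟨⟨a, ha⟩, rfl⟩

/-- The commutator subgroup surjects onto `G`, so together with the center it generates `Hat G`, and
both groups have the same commutators. -/
instance Hat.isPerfect_commutator {G : Type u} [Group G] [Group.IsPerfect G] :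
    Group.IsPerfect (commutator (Hat G)) := by
  rw [Group.isPerfect_def, eq_top_iff]
  intro x _
  obtain ⟨y, hy, hyx⟩ := (commutator_eq_map_of_ker _ _ Hat.ker_proj_le_center
    Hat.proj_comp_subtype_surjective).le x.2
  rwa [← Subtype.ext (a1 := y) (a2 := x) hyx]

namespace CentralExtension

variable {G : Type u} [Group G]

/-- The homomorphism over `G` from the universal cocycle extension. -/
def hat (e : CentralExtension G) : Hat G →* e.E :=
  e.hatHom (Function.surjInv e.surjective) (Function.surjInv_eq e.surjective)

lemma hom_hat (e : CentralExtension G) (a : Hat G) : e.hom (e.hat a) = Hat.proj a :=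
  DFunLike.congr_fun (e.hom_comp_hatHom _ _) a

/-- The differential of a central extension. -/
def differential (e : CentralExtension G) : H2 G →+ Additive e.hom.ker :=
  (e.factorHom (Function.surjInv e.surjective) (Function.surjInv_eq e.surjective)).comp
    CocycleGroup.ofH2

lemma coe_differential (e : CentralExtension G) (x : H2 G) :
    ((e.differential x).toMul : e.E) = e.hat (Hat.ofH2 x) :=
  (e.hatHom_inc _ _ _).symm

/-- The homomorphisms `Hat G → E` given by two sections agree on commutators, hence on `H₂(G)`. -/
lemma isDifferential_differential (e : CentralExtension G) : e.IsDifferential e.differential := by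
  intro s hs z
  have h1 : e.hat (Hat.ofH2 (groupHomology.H2π (trivialInt G) z)) =
      e.hatHom s hs (Hat.ofH2 (groupHomology.H2π (trivialInt G) z)) :=
    eqOn_commutator e.hom e.central _ _
      ((e.hom_comp_hatHom _ _).trans (e.hom_comp_hatHom _ _).symm) (Hat.ofH2_mem_commutator _)
  rw [← coe_differential, Hat.ofH2, hatHom_inc, CocycleGroup.ofH2_H2π] at h1
  have h2 := Additive.toMul.injective (Subtype.ext h1)
  exact h2.trans (CocycleGroup.lift_mk _ _ _)

/-- Exactness of `H₂(E) → H₂(G) → ker e`. -/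
lemma mem_range_H2Map (e : CentralExtension G) (x : H2 G) :
    x ∈ (H2Map e.hom).range ↔ e.hat (Hat.ofH2 x) = 1 := by
  have hover : e.hom.comp (e.hat.comp (Hat.map e.hom)) = e.hom.comp Hat.proj := by
    ext a
    simp [hom_hat]
  have heq : ∀ a ∈ commutator (Hat e.E), e.hat (Hat.map e.hom a) = Hat.proj a :=
    fun a ha => eqOn_commutator e.hom e.central _ _ hover ha
  constructor
  · rintro ⟨y, rfl⟩
    rw [← Hat.map_ofH2, heq _ (Hat.ofH2_mem_commutator y), Hat.proj_ofH2]
  · intro h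
    -- `x` lifts to a product of commutators in `Hat E`, whose projection to `E` is `e.hat` of `x`,
    -- hence trivial; so the lift comes from `H₂(E)`.
    have hx := Hat.ofH2_mem_commutator x
    rw [commutator_eq_map_of_ker (Hat.map e.hom) Hat.proj Hat.ker_proj_le_center
      (e.surjective.comp Hat.proj_surjective)] at hx
    obtain ⟨a, ha, hax⟩ := hx
    obtain ⟨y, rfl⟩ := Hat.exists_ofH2 ha (by rw [← heq a ha, hax, h])
    rw [Hat.map_ofH2] at hax
    exact ⟨y, Hat.ofH2_injective hax⟩

lemma exists_commutator_hat (e : CentralExtension G) [Group.IsPerfect e.E] :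
    Function.Surjective (e.hat.comp (commutator (Hat G)).subtype) := by
  intro y
  have hy : y ∈ commutator e.E := by simp
  rw [commutator_eq_map_of_ker e.hat e.hom e.central (fun g => by
    obtain ⟨a, rfl⟩ := Hat.proj_surjective g
    exact ⟨a, e.hom_hat a⟩)] at hy
  obtain ⟨a, ha, rfl⟩ := hy
  exact ⟨⟨a, ha⟩, rfl⟩

/-- Lifting an endomorphism of `G` to perfect central extensions. -/
lemma exists_lift (e d : CentralExtension G) [Group.IsPerfect e.E] (σ : G →* G)
    (h : (H2Map e.hom).range.map (H2Map σ) ≤ (H2Map d.hom).range) :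
    ∃ k : e.E →* d.E, d.hom.comp k = σ.comp e.hom := by
  let P := e.hat.comp (commutator (Hat G)).subtype
  have hP : Function.Surjective P := e.exists_commutator_hat
  let Q : commutator (Hat G) →* d.E :=
    (d.hat.comp (Hat.map σ)).comp (commutator (Hat G)).subtype
  -- By exactness `Ker P` is the image of `H₂(e)`; `H₂(σ)` sends it into the image of `H₂(d)`, which
  -- `d.hat` kills.
  have hPQ : P.ker ≤ Q.ker := by
    intro u hu
    have hu1 : e.hat u = 1 := hu
    obtain ⟨x, hx⟩ := Hat.exists_ofH2 u.2 (by rw [← e.hom_hat, hu1, map_one])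
    rw [← hx, ← mem_range_H2Map] at hu1
    have := (d.mem_range_H2Map _).mp (h ⟨x, hu1, rfl⟩)
    rw [← Hat.map_ofH2, hx] at this
    exact this
  refine ⟨P.liftOfSurjective hP ⟨Q, hPQ⟩, ?_⟩
  ext y
  obtain ⟨u, rfl⟩ := hP y
  have : P.liftOfSurjective hP ⟨Q, hPQ⟩ (P u) = Q u :=
    MonoidHom.liftOfRightInverse_comp_apply _ _ _ _ u
  simp only [MonoidHom.comp_apply, this]
  simp [P, Q, hom_hat]

/-- Perfect central extensions are determined by the images of their Schur multipliers. -/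
lemma exists_mulEquiv (e d : CentralExtension G) [Group.IsPerfect e.E] [Group.IsPerfect d.E]
    (h : (H2Map e.hom).range = (H2Map d.hom).range) :
    ∃ k : e.E ≃* d.E, d.hom.comp k.toMonoidHom = e.hom := by
  have hid : ∀ L : AddSubgroup (H2 G), L.map (H2Map (MonoidHom.id G)) = L := fun L => by
    have : H2Map (MonoidHom.id G) = AddMonoidHom.id _ := AddMonoidHom.ext H2Map_id
    rw [this, AddSubgroup.map_id]
  obtain ⟨k, hk⟩ := e.exists_lift d (MonoidHom.id G) (by rw [hid, h])
  obtain ⟨l, hl⟩ := d.exists_lift e (MonoidHom.id G) (by rw [hid, h])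
  refine ⟨MonoidHom.toMulEquiv k l ?_ ?_, hk⟩
  · apply eq_of_isPerfect e.hom e.central
    rw [← MonoidHom.comp_assoc, hl]
    exact hk
  · apply eq_of_isPerfect d.hom d.central
    rw [← MonoidHom.comp_assoc, hk]
    exact hl

/-- A nontrivial homomorphism from a perfect central extension of a finite simple group to that
group is the projection followed by an automorphism. -/
lemma exists_automorphism [Finite G] [IsSimpleGroup G] (e : CentralExtension G)
    [Group.IsPerfect e.E] (f : e.E →* G) (hf : f ≠ 1) :
    ∃ σ : G ≃* G, f = σ.toMonoidHom.comp e.hom := by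
  have hn : (f.ker.map e.hom).Normal := Subgroup.Normal.map inferInstance _ e.surjective
  rcases IsSimpleGroup.eq_bot_or_eq_top_of_normal _ hn with h | h
  -- Here `Ker f ≤ Ker e`, so the range of `f` maps onto `G`; by counting, it is all of `G` and the
  -- map is bijective.
  · rw [Subgroup.map_eq_bot_iff] at h
    let r : f.range →* G := f.rangeRestrict.liftOfSurjective f.rangeRestrict_surjective
      ⟨e.hom, by rwa [MonoidHom.ker_rangeRestrict]⟩
    have hr : ∀ x, r (f.rangeRestrict x) = e.hom x :=
      fun x => MonoidHom.liftOfRightInverse_comp_apply _ _ _ _ x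
    have hrs : Function.Surjective r := fun g => by
      obtain ⟨x, rfl⟩ := e.surjective g
      exact ⟨_, hr x⟩
    have htop : f.range = ⊤ :=
      Subgroup.eq_top_of_card_eq _ (le_antisymm (Subgroup.card_le_card_group _)
        (Nat.card_le_card_of_surjective r hrs))
    have hrb : Function.Bijective r := by
      refine (Nat.bijective_iff_surjective_and_card r).mpr ⟨hrs, ?_⟩
      rw [htop, Subgroup.card_top]
    let ρ := MulEquiv.ofBijective r hrb
    refine ⟨ρ.symm.trans ((MulEquiv.subgroupCongr htop).trans Subgroup.topEquiv), ?_⟩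
    ext x
    have : ρ.symm (e.hom x) = f.rangeRestrict x := by
      rw [MulEquiv.symm_apply_eq]
      exact (hr x).symm
    simp [this]
  -- Here `Ker f` surjects onto `G`, so it is all of the perfect group `E`.
  · exfalso
    apply hf
    have h1 := surjective_of_isPerfect f.ker.subtype e.hom e.central (fun g => by
      obtain ⟨x, hx, rfl⟩ := h ▸ Subgroup.mem_top g
      exact ⟨⟨x, hx⟩, rfl⟩)
    ext x
    obtain ⟨y, rfl⟩ := h1 x
    exact y.2

/-- A perfect central extension with invariant image of its Schur multiplier is a cellular
cover. -/
lemma isCellularCover [Finite G] [IsSimpleGroup G] (e : CentralExtension G)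
    [Group.IsPerfect e.E] (h : IsInvariant (H2Map e.hom).range) : IsCellularCover e.hom := by
  refine ⟨fun f g hfg => eq_of_isPerfect e.hom e.central f g hfg, fun f => ?_⟩
  by_cases hf : f = 1
  · exact ⟨1, by ext; simp [hf]⟩
  · obtain ⟨σ, rfl⟩ := e.exists_automorphism f hf
    exact e.exists_lift e σ.toMonoidHom (h σ).le

variable (G) in
/-- The commutator subgroup of the universal cocycle extension. -/
def universal [Group.IsPerfect G] : CentralExtension G where
  E := commutator (Hat G)
  hom := Hat.proj.comp (commutator (Hat G)).subtype
  surjective := Hat.proj_comp_subtype_surjective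
  central := by
    intro x hx
    have := Subgroup.mem_center_iff.mp (Hat.ker_proj_le_center (show (x : Hat G) ∈ _ from hx))
    exact Subgroup.mem_center_iff.mpr fun y => Subtype.ext (this y)

instance [Group.IsPerfect G] : Group.IsPerfect (universal G).E :=
  inferInstanceAs (Group.IsPerfect (commutator (Hat G)))

lemma universal_isUniversal [Group.IsPerfect G] : (universal G).IsUniversal := by
  intro d
  refine ⟨d.hat.comp (commutator (Hat G)).subtype, ?_, fun k hk => ?_⟩
  · ext x
    exact d.hom_hat _
  · apply eq_of_isPerfect d.hom d.central
    refine hk.trans ?_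
    ext x
    exact (d.hom_hat _).symm

lemma IsUniversal.exists_mulEquiv {e d : CentralExtension G} (he : e.IsUniversal)
    (hd : d.IsUniversal) : ∃ k : e.E ≃* d.E, d.hom.comp k.toMonoidHom = e.hom := by
  obtain ⟨k, hk, -⟩ := he d
  obtain ⟨l, hl, -⟩ := hd e
  refine ⟨MonoidHom.toMulEquiv k l ?_ ?_, hk⟩
  · refine (he e).unique ?_ rfl
    rw [← MonoidHom.comp_assoc, hl, hk]
  · refine (hd d).unique ?_ rfl
    rw [← MonoidHom.comp_assoc, hk, hl]

variable [Group.IsPerfect G] {e : CentralExtension G}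

lemma IsUniversal.isPerfect (he : e.IsUniversal) : Group.IsPerfect e.E := by
  obtain ⟨k, -⟩ := universal_isUniversal.exists_mulEquiv he
  exact Group.IsPerfect.ofSurjective (f := k.toMonoidHom) k.surjective

/-- The map `e.hat` restricts to an isomorphism from the commutator subgroup of `Hat G` to `E` over
`G`; on kernels it is the differential. -/
lemma IsUniversal.differential_bijective (he : e.IsUniversal) :
    Function.Bijective e.differential := by
  obtain ⟨k, hk⟩ := universal_isUniversal.exists_mulEquiv he
  have h1 : e.hat.comp (commutator (Hat G)).subtype = k.toMonoidHom := by
    apply eq_of_isPerfect e.hom e.central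
    refine Eq.trans ?_ hk.symm
    ext x
    exact e.hom_hat _
  have h2 : ∀ x, ((e.differential x).toMul : e.E) =
      k ⟨Hat.ofH2 x, Hat.ofH2_mem_commutator x⟩ := fun x => by
    rw [coe_differential]
    exact DFunLike.congr_fun h1 ⟨Hat.ofH2 x, Hat.ofH2_mem_commutator x⟩
  constructor
  · intro x y hxy
    have := (h2 x).symm.trans ((congrArg (fun t => (t.toMul : e.E)) hxy).trans (h2 y))
    exact Hat.ofH2_injective (congrArg Subtype.val (k.injective this))
  · intro y
    have hy : e.hom (y.toMul : e.E) = 1 := y.toMul.2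
    obtain ⟨u, hu⟩ := k.surjective (y.toMul : e.E)
    obtain ⟨x, hx⟩ := Hat.exists_ofH2 (X := G) u.2 (by
      have := DFunLike.congr_fun hk u
      refine Eq.trans this.symm ?_
      change e.hom (k u) = 1
      rw [hu, hy])
    refine ⟨x, Additive.toMul.injective (Subtype.ext ?_)⟩
    rw [h2, ← hu]
    congr 1
    exact Subtype.ext hx

lemma IsUniversal.isPerfect_quot (he : e.IsUniversal) (K : Subgroup e.hom.ker) :
    Group.IsPerfect (e.quot K).E := by
  have := he.isPerfect
  exact Group.IsPerfect.ofSurjective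
    (f := QuotientGroup.mk' (K.map e.hom.ker.subtype)) (QuotientGroup.mk'_surjective _)

/-- The differential of `E/K` is that of `e` followed by reduction modulo `K`, so its kernel is `L`;
exactness identifies this kernel with the range. -/
lemma IsUniversal.range_H2Map_quot (he : e.IsUniversal) (L : AddSubgroup (H2 G)) :
    (H2Map (e.quot (AddSubgroup.toSubgroup' (L.map e.differential))).hom).range = L := by
  ext x
  rw [mem_range_H2Map]
  set K : Subgroup e.hom.ker := AddSubgroup.toSubgroup' (L.map e.differential) with hK
  have h1 : (e.quot K).hat (Hat.ofH2 x) =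
      (QuotientGroup.mk' (K.map e.hom.ker.subtype)) (e.hat (Hat.ofH2 x)) := by
    refine eqOn_commutator (e.quot K).hom (e.quot K).central (e.quot K).hat
      ((QuotientGroup.mk' (K.map e.hom.ker.subtype)).comp e.hat) ?_ (Hat.ofH2_mem_commutator x)
    ext a
    exact ((e.quot K).hom_hat a).trans (e.hom_hat a).symm
  rw [h1]
  refine (QuotientGroup.eq_one_iff _).trans ?_
  rw [← coe_differential]
  constructor
  · rintro ⟨k, ⟨y, hy, hyk⟩, hk⟩
    have : e.differential y = e.differential x := by
      rw [hyk]
      exact congrArg Additive.ofMul (Subtype.ext hk)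
    rwa [← he.differential_bijective.1 this]
  · intro hx
    exact ⟨_, ⟨x, hx, rfl⟩, rfl⟩

end CentralExtension

/-! ### Classification of covers by invariant subgroups -/

section Covers

variable {G : Type u} [Group G]

lemma range_H2Map_le {A B : Type u} [Group A] [Group B] {c : A →* G} {d : B →* G} (h : A →* B)
    (hd : d.comp h = c) : (H2Map c).range ≤ (H2Map d).range := by
  rintro _ ⟨x, rfl⟩
  exact ⟨H2Map h x, by rw [← H2Map_comp, hd]⟩

/-- Lifting `σ ∘ c` through `c` gives one inclusion, and `σ⁻¹` gives the other. -/
lemma IsCellularCover.isInvariant {A : Type u} [Group A] {c : A →* G} (hc : IsCellularCover c) :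
    IsInvariant (H2Map c).range := by
  have hle : ∀ σ : G ≃* G, (H2Map c).range.map (H2Map σ.toMonoidHom) ≤ (H2Map c).range := by
    rintro σ _ ⟨_, ⟨x, rfl⟩, rfl⟩
    obtain ⟨h, hh⟩ := hc.exists_lift (σ.toMonoidHom.comp c)
    exact ⟨H2Map h x, by rw [← H2Map_comp, ← H2Map_comp, hh]⟩
  intro σ
  refine le_antisymm (hle σ) fun x hx => ?_
  refine ⟨H2Map σ.symm.toMonoidHom x, hle σ.symm ⟨x, hx, rfl⟩, ?_⟩
  rw [← H2Map_comp]
  have : σ.toMonoidHom.comp σ.symm.toMonoidHom = MonoidHom.id G := by ext; simp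
  rw [this, H2Map_id]

/-- The central extension underlying a surjective cellular cover. -/
def CellularCover.toCentralExtension (c : CellularCover G) (hs : Function.Surjective c.hom) :
    CentralExtension G := ⟨c.A, c.hom, hs, c.isCellularCover.ker_le_center⟩

open Classical in
/-- The image of the Schur multiplier of a surjective cover, or the additional point. -/
def CellularCover.image (c : CellularCover G) : Unit ⊕ InvSub G :=
  if Function.Surjective c.hom then Sum.inr ⟨(H2Map c.hom).range, c.isCellularCover.isInvariant⟩
  else Sum.inl ()

lemma CellularCover.image_of_surjective (c : CellularCover G) (hs : Function.Surjective c.hom) :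
    c.image = Sum.inr ⟨(H2Map c.hom).range, c.isCellularCover.isInvariant⟩ := if_pos hs

lemma CellularCover.image_of_not_surjective (c : CellularCover G)
    (hs : ¬ Function.Surjective c.hom) : c.image = Sum.inl () := if_neg hs

/-- The image of the Schur multiplier, on equivalence classes of covers. -/
def Cov.image : Cov G → Unit ⊕ InvSub G :=
  Quotient.lift CellularCover.image (by
    rintro c d ⟨h, hh⟩
    have hiff : Function.Surjective c.hom ↔ Function.Surjective d.hom := by
      rw [← hh]
      exact ⟨fun hs => Function.Surjective.of_comp hs, fun hs => hs.comp h.surjective⟩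
    by_cases hs : Function.Surjective c.hom
    · rw [c.image_of_surjective hs, d.image_of_surjective (hiff.mp hs)]
      congr 1
      refine Subtype.ext (le_antisymm (range_H2Map_le h.toMonoidHom hh)
        (range_H2Map_le h.symm.toMonoidHom ?_))
      rw [← hh]
      ext x
      simp
    · rw [c.image_of_not_surjective hs, d.image_of_not_surjective (fun h => hs (hiff.mpr h))])

lemma CellularCover.subsingleton_iff [IsSimpleGroup G] (c : CellularCover G) :
    Subsingleton c.A ↔ ¬ Function.Surjective c.hom := by
  constructor
  · intro h hs
    exact not_subsingleton G hs.subsingleton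
  · exact c.isCellularCover.subsingleton_or_surjective.resolve_right

/-- `Hat G` is central over a cyclic group, hence abelian, while `H₂(G)` embeds in its commutator
subgroup. -/
lemma subsingleton_H2_of_comm [Finite G] [IsSimpleGroup G] (hG : ∀ x y : G, x * y = y * x) :
    Subsingleton (H2 G) := by
  let _ : CommGroup G := { (inferInstance : Group G) with mul_comm := hG }
  have := (Hat.proj (X := G)).isMulCommutative_of_isCyclic_of_ker_le_center Hat.ker_proj_le_center
  have hcomm : ∀ a b : Hat G, a * b = b * a := fun a b => mul_comm' a b
  have hbot : commutator (Hat G) ≤ ⊥ := by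
    rw [commutator_def, Subgroup.commutator_le]
    intro a _ b _
    change a * b * a⁻¹ * b⁻¹ = 1
    rw [hcomm a b]
    group
  have h1 : ∀ x : H2 G, Hat.ofH2 x = 1 := fun x => hbot (Hat.ofH2_mem_commutator x)
  exact ⟨fun x y => Hat.ofH2_injective ((h1 x).trans (h1 y).symm)⟩

variable [Finite G] [IsSimpleGroup G]

lemma CellularCover.toCov_eq_of_range_eq (c d : CellularCover G)
    (hc : Function.Surjective c.hom) (hd : Function.Surjective d.hom)
    (h : (H2Map c.hom).range = (H2Map d.hom).range) : c.toCov = d.toCov := by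
  by_cases hG : ∀ x y : G, x * y = y * x
  · exact toCov_eq_of_mulEquiv c d
      ((MulEquiv.ofBijective c.hom (c.isCellularCover.bijective_of_comm hG hc)).trans
        (MulEquiv.ofBijective d.hom (d.isCellularCover.bijective_of_comm hG hd)).symm)
  · push Not at hG
    have := isPerfect_of_nonabelian hG
    have hZ := center_eq_bot_of_nonabelian hG
    have : Group.IsPerfect (c.toCentralExtension hc).E := c.isCellularCover.isPerfect hZ hc
    have : Group.IsPerfect (d.toCentralExtension hd).E := d.isCellularCover.isPerfect hZ hd
    obtain ⟨k, hk⟩ := (c.toCentralExtension hc).exists_mulEquiv (d.toCentralExtension hd) h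
    exact toCov_eq_of_mulEquiv c d k

lemma Cov.image_injective : Function.Injective (Cov.image (G := G)) := by
  intro x y hxy
  obtain ⟨c, rfl⟩ := Quotient.exists_rep x
  obtain ⟨d, rfl⟩ := Quotient.exists_rep y
  change c.image = d.image at hxy
  by_cases hc : Function.Surjective c.hom <;> by_cases hd : Function.Surjective d.hom
  · rw [c.image_of_surjective hc, d.image_of_surjective hd] at hxy
    exact c.toCov_eq_of_range_eq d hc hd (congrArg Subtype.val (Sum.inr_injective hxy))
  · rw [c.image_of_surjective hc, d.image_of_not_surjective hd] at hxy
    exact absurd hxy (by simp)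
  · rw [c.image_of_not_surjective hc, d.image_of_surjective hd] at hxy
    exact absurd hxy (by simp)
  · have := c.subsingleton_iff.mpr hc
    have := d.subsingleton_iff.mpr hd
    let _ : Unique c.A := uniqueOfSubsingleton 1
    let _ : Unique d.A := uniqueOfSubsingleton 1
    exact toCov_eq_of_mulEquiv c d MulEquiv.ofUnique

lemma CentralExtension.IsUniversal.isCellularCover_quot [Group.IsPerfect G]
    {e : CentralExtension G} (he : e.IsUniversal) (L : InvSub G) :
    IsCellularCover (e.quot (AddSubgroup.toSubgroup' (L.1.map e.differential))).hom := by
  have := he.isPerfect_quot (AddSubgroup.toSubgroup' (L.1.map e.differential))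
  apply CentralExtension.isCellularCover
  rw [he.range_H2Map_quot]
  exact L.2

lemma CentralExtension.IsUniversal.image_quot [Group.IsPerfect G]
    {e : CentralExtension G} (he : e.IsUniversal) (L : InvSub G) :
    CellularCover.image ⟨_, _, he.isCellularCover_quot L⟩ = Sum.inr L := by
  rw [CellularCover.image_of_surjective _ (CentralExtension.surjective _)]
  congr 1
  exact Subtype.ext (he.range_H2Map_quot L.1)

lemma Cov.image_surjective : Function.Surjective (Cov.image (G := G)) := by
  rintro (⟨⟩ | L)
  · let c : CellularCover G := ⟨PUnit, 1, fun _ _ _ => by ext,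
      fun f => ⟨1, by ext x; exact (map_one f).symm⟩⟩
    refine ⟨c.toCov, c.image_of_not_surjective (c.subsingleton_iff.mp ?_)⟩
    exact inferInstanceAs (Subsingleton PUnit)
  · by_cases hG : ∀ x y : G, x * y = y * x
    · have := subsingleton_H2_of_comm hG
      let c : CellularCover G := ⟨G, MonoidHom.id G, fun _ _ h => h, fun f => ⟨f, rfl⟩⟩
      refine ⟨c.toCov, (c.image_of_surjective Function.surjective_id).trans ?_⟩
      congr 1
      exact Subtype.ext (Subsingleton.elim _ _)
    · push Not at hG
      have := isPerfect_of_nonabelian hG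
      exact ⟨CellularCover.toCov _, CentralExtension.universal_isUniversal.image_quot L⟩

variable (G) in
/-- The equivalence classes of cellular covers correspond to the invariant subgroups of the Schur
multiplier and one additional point. -/
def covEquivInvSub : Cov G ≃ Unit ⊕ InvSub G :=
  Equiv.ofBijective Cov.image ⟨Cov.image_injective, Cov.image_surjective⟩

/-- The nontrivial values of idempotent functors are the sources of the surjective covers. -/
lemma mem_idem_and_nontrivial_iff (A : Type u) [Group A] :
    (isoClass A ∈ Idem G ∧ Nontrivial A) ↔
      ∃ c : CellularCover G, Function.Surjective c.hom ∧ Nonempty (A ≃* c.A) := by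
  constructor
  · rintro ⟨h, hA⟩
    obtain ⟨x, hx⟩ := exists_cov_of_mem_idem h
    obtain ⟨c, rfl⟩ := Quotient.exists_rep x
    obtain ⟨k⟩ := isoClass_eq_iff.mp (show isoClass c.A = isoClass A from hx)
    refine ⟨c, c.isCellularCover.subsingleton_or_surjective.resolve_left fun hs => ?_, ⟨k.symm⟩⟩
    exact not_subsingleton A k.symm.injective.subsingleton
  · rintro ⟨c, hc, ⟨k⟩⟩
    refine ⟨isoClass_eq_iff.mpr ⟨k⟩ ▸ c.isCellularCover.mem_idem, ?_⟩
    exact (hc.comp k.surjective).nontrivial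

end Covers
end IdemGroups
end

theorem theoremC (G : Type u) [Group G] [Finite G] [IsSimpleGroup G] :
    ∃ (α : Cov G ≃ Idem G) (β : Cov G ≃ Unit ⊕ InvSub G),
      -- `α` sends the class of a cellular cover `c : A → G` to the isomorphism class of `A`
      (∀ c : CellularCover G, (α c.toCov : IsoClass.{u}) = isoClass c.A) ∧
      -- `β` sends the trivial cover to `0` and a surjective cover `c` to the image of `H₂(c)`
      (∀ c : CellularCover G,
        (Subsingleton c.A ∧ β c.toCov = Sum.inl ()) ∨
        (Function.Surjective c.hom ∧ ∃ L : InvSub G,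
          β c.toCov = Sum.inr L ∧ L.1 = (H2Map c.hom).range)) ∧
      -- if `G` is not abelian, it has a universal central extension `E`, whose kernel is `H₂(G)`,
      -- and the nontrivial values are the groups `E/K` with `K` invariant in `H₂(G)`
      ((∃ x y : G, x * y ≠ y * x) →
        (∃ e : CentralExtension G, e.IsUniversal) ∧
        ∀ e : CentralExtension G, e.IsUniversal →
          ∃ μ : H2 G ≃+ Additive e.hom.ker,
            e.IsDifferential μ.toAddMonoidHom ∧
            (∀ L : InvSub G,
              ∃ hc : IsCellularCover
                  (e.quot (AddSubgroup.toSubgroup' (L.1.map μ.toAddMonoidHom))).hom,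
                β (CellularCover.toCov ⟨_, _, hc⟩) = Sum.inr L) ∧
            (∀ (A : Type u) [Group A],
              (isoClass A ∈ Idem G ∧ Nontrivial A) ↔
                ∃ L : InvSub G, Nonempty
                  (A ≃* (e.quot (AddSubgroup.toSubgroup' (L.1.map μ.toAddMonoidHom))).E))) ∧
      -- if `G` is abelian, then `H₂(G) = 0` and the only nontrivial value is `G`
      ((∀ x y : G, x * y = y * x) →
        Subsingleton (H2 G) ∧
        ∀ (A : Type u) [Group A],
          (isoClass A ∈ Idem G ∧ Nontrivial A) ↔ Nonempty (A ≃* G)) := by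
  refine ⟨covEquivIdem G, covEquivInvSub G, fun c => rfl, fun c => ?_, fun hG => ?_, fun hG => ?_⟩
  · by_cases hs : Function.Surjective c.hom
    · exact Or.inr ⟨hs, ⟨_, c.isCellularCover.isInvariant⟩, c.image_of_surjective hs, rfl⟩
    · exact Or.inl ⟨c.subsingleton_iff.mpr hs, c.image_of_not_surjective hs⟩
  · have := isPerfect_of_nonabelian hG
    refine ⟨⟨_, CentralExtension.universal_isUniversal⟩, fun e he =>
      ⟨AddEquiv.ofBijective e.differential he.differential_bijective,
        e.isDifferential_differential,
        fun L => ⟨he.isCellularCover_quot L, he.image_quot L⟩, fun A _ => ?_⟩⟩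
    rw [mem_idem_and_nontrivial_iff]
    constructor
    · rintro ⟨c, hc, ⟨k⟩⟩
      refine ⟨⟨_, c.isCellularCover.isInvariant⟩, ?_⟩
      -- The cover `c` and the quotient of `E` by the image of `H₂(c)` have the same invariant, so
      -- they are equivalent.
      have h := (he.image_quot ⟨_, c.isCellularCover.isInvariant⟩).trans
        (c.image_of_surjective hc).symm
      obtain ⟨l, -⟩ := Quotient.exact
        (Cov.image_injective (a₁ := CellularCover.toCov _) (a₂ := c.toCov) h)
      exact ⟨k.trans l.symm⟩
    · rintro ⟨L, ⟨k⟩⟩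
      exact ⟨⟨_, _, he.isCellularCover_quot L⟩, CentralExtension.surjective _, ⟨k⟩⟩
  · refine ⟨subsingleton_H2_of_comm hG, fun A _ => ?_⟩
    rw [mem_idem_and_nontrivial_iff]
    constructor
    · rintro ⟨c, hc, ⟨k⟩⟩
      exact ⟨k.trans (MulEquiv.ofBijective c.hom (c.isCellularCover.bijective_of_comm hG hc))⟩
    · rintro ⟨k⟩
      exact ⟨⟨G, MonoidHom.id G, fun _ _ h => h, fun f => ⟨f, rfl⟩⟩, Function.surjective_id, ⟨k⟩⟩
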